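/- Let $\varphi$ be a primitive substitution on a finite alphabet $\mathcal A$, and let $a\in\mathcal A$ be a letter that is fixed of order $k\ge 1$, i.e. $\varphi^k(a)$ begins with $a$. A return word to $a$ is a word $v=au$ such that $a$ does not occur in $u$ and $va$ is admitted by $\varphi$ (i.e. is a subword of some $\varphi^n(b)$, $b\in\mathcal A$, $n\ge 0$). Let $\mathcal R$ be the set of return words to $a$, and let $\psi$ be the pre-left properisation of $\varphi$: the substitution on the alphabet $\mathcal R$ which sends $v\in\mathcal R$ to the unique decomposition of $\varphi^k(v)$ into return words to $a$. For a substitution $\theta$, let $X_\theta$ be the set of bi-infinite sequences all of whose subwords are admitted by $\theta$, with the product topology and the shift $\sigma$, let $\Omega_\theta=(X_\theta\times[0,1])/\!\sim$, where $\sim$ is generated by $(s,0)\sim(\sigma(s),1)$, be its tiling space, let $M_\theta$ be its substitution matrix (the $(i,j)$ entry is the number of occurrences of the letter $i$ in $\theta(j)$), and let $\check H^1$ denote first Čech cohomology with integer coefficients. Then: 1. $\mathcal R$ is finite and, if $\mathcal R\neq\emptyset$, some power $\psi^i$, $i\ge 1$, is left proper: there is $v_0\in\mathcal R$ such that for every $v\in\mathcal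 R$, $\psi^i(v)=v_0w_v$ with $w_v$ a non-empty word. ($\mathcal R=\emptyset$ happens only for $\mathcal A=\{a\}$, $\varphi(a)=a$.) 2. $\check H^1(\Omega_\psi)\cong\check H^1(\Omega_\varphi)$. 3. If moreover $\varphi$ is recognisable (every $s\in X_\varphi$ can be cut in exactly one way into words $\varphi(t_i)$ with $(t_i)_{i\in\mathbb Z}\in X_\varphi$, up to renumbering), then $\check H^1(\Omega_\varphi)\cong\varinjlim M_\psi^T$, the direct limit of $\mathbb Z^{\mathcal R}\to\mathbb Z^{\mathcal R}\to\cdots$ with all maps equal to $M_\psi^T$. -/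

import Mathlib

open TopologicalSpace

universe u

/-! ### Substitutions -/

/-- A substitution on the alphabet `A`: every letter is sent to a non-empty word. -/
structure Substitution (A : Type u) where
  /-- the image of a letter -/
  toFun : A → List A
  ne_nil : ∀ a, toFun a ≠ []

namespace Substitution

variable {A : Type u}

/-- The extension of a substitution to words, by concatenation. -/
def onWord (φ : Substitution A) (w : List A) : List A := w.flatMap φ.toFun

/-- The word `φⁿ(w)`. -/
def iter (φ : Substitution A) (n : ℕ) (w : List A) : List A := φ.onWord^[n] w

theorem onWord_append (φ : Substitution A) (v w : List A) :
    φ.onWord (v ++ w) = φ.onWord v ++ φ.onWord w := by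
  simp [onWord]

theorem iter_append (φ : Substitution A) (n : ℕ) (v w : List A) :
    φ.iter n (v ++ w) = φ.iter n v ++ φ.iter n w := by
  induction n generalizing v w with
  | zero => rfl
  | succ n ih =>
    simp only [iter, Function.iterate_succ_apply] at ih ⊢
    rw [onWord_append, ih]

theorem onWord_ne_nil (φ : Substitution A) {w : List A} (hw : w ≠ []) : φ.onWord w ≠ [] := by
  cases w with
  | nil => exact absurd rfl hw
  | cons b t => simp [onWord, φ.ne_nil b]

theorem iter_ne_nil (φ : Substitution A) (n : ℕ) {w : List A} (hw : w ≠ []) :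
    φ.iter n w ≠ [] := by
  induction n generalizing w with
  | zero => exact hw
  | succ n ih =>
    simp only [iter, Function.iterate_succ_apply] at ih ⊢
    exact ih (φ.onWord_ne_nil hw)

/-- The `n`-th power of a substitution. -/
def pow (φ : Substitution A) (n : ℕ) : Substitution A where
  toFun a := φ.iter n [a]
  ne_nil _ := φ.iter_ne_nil n (by simp)

/-- A word is admitted by `φ` if it is empty or a subword of some `φⁿ(a)`, `n ≥ 0`. -/
def Admitted (φ : Substitution A) (w : List A) : Prop :=
  w = [] ∨ ∃ (a : A) (n : ℕ), w <:+: φ.iter n [a]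

theorem Admitted.of_infix {φ : Substitution A} {v w : List A} (hw : φ.Admitted w)
    (h : v <:+: w) : φ.Admitted v := by
  rcases hw with rfl | ⟨a, n, hn⟩
  · exact Or.inl (List.infix_nil.mp h)
  · exact Or.inr ⟨a, n, h.trans hn⟩

theorem Admitted.iter {φ : Substitution A} {w : List A} (hw : φ.Admitted w) (k : ℕ) :
    φ.Admitted (φ.iter k w) := by
  rcases hw with rfl | ⟨a, n, x, y, hxy⟩
  · left
    induction k with
    | zero => rfl
    | succ k ih =>
      simpa only [Substitution.iter, Function.iterate_succ_apply, onWord, List.flatMap_nil] using ih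
  · refine Or.inr ⟨a, k + n, φ.iter k x, φ.iter k y, ?_⟩
    rw [← iter_append, ← iter_append, hxy]
    simp only [Substitution.iter, Function.iterate_add_apply]

/-! ### Subshift, tiling space -/

/-- The subshift `X_φ`: all bi-infinite sequences all of whose subwords are admitted. -/
def Subshift (φ : Substitution A) : Type u :=
  {s : ℤ → A // ∀ (i : ℤ) (n : ℕ), φ.Admitted (List.ofFn fun j : Fin n => s (i + (j : ℕ)))}

/-- `X_φ` carries the topology induced by the product topology on `A^ℤ`, `A` being discrete. -/
instance (φ : Substitution A) : TopologicalSpace φ.Subshift :=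
  TopologicalSpace.induced (fun s : φ.Subshift => s.1)
    (@Pi.topologicalSpace ℤ (fun _ => A) (fun _ => ⊥))

/-- The shift map, `σ(s)ᵢ = sᵢ₊₁`. -/
def shift (φ : Substitution A) (s : φ.Subshift) : φ.Subshift :=
  ⟨fun i => s.1 (i + 1), fun i n => by
    have h := s.2 (i + 1) n
    simpa only [add_right_comm] using h⟩

/-- The relation `(s, 0) ∼ (σ(s), 1)` on `X_φ × [0, 1]`. -/
def GlueRel (φ : Substitution A) (p q : φ.Subshift × unitInterval) : Prop :=
  p.2 = 0 ∧ q = (φ.shift p.1, 1)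

/-- The tiling space `Ω_φ`: the topological quotient of `X_φ × [0, 1]` by the equivalence relation
generated by `(s, 0) ∼ (σ(s), 1)`. -/
def TilingSpace (φ : Substitution A) : Type u := Quot φ.GlueRel

instance (φ : Substitution A) : TopologicalSpace φ.TilingSpace :=
  inferInstanceAs (TopologicalSpace (Quot φ.GlueRel))

/-! ### Substitution matrix, primitivity, recognisability, properness -/

open Classical in
/-- The substitution matrix: the entry `(i, j)` is the number of occurrences of `i` in `φ(j)`. -/
noncomputable def matrix (φ : Substitution A) : Matrix A A ℤ :=
  Matrix.of fun i j => ((φ.toFun j).count i : ℤ)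

open Classical in
/-- `φ` is primitive if some positive power of its matrix has strictly positive entries. -/
def IsPrimitive [Fintype A] (φ : Substitution A) : Prop :=
  ∃ p : ℕ, 0 < p ∧ ∀ i j, 0 < (φ.matrix ^ p) i j

/-- `s = … φ(t₋₁) φ(t₀) φ(t₁) …`, the word `φ(tᵢ)` occupying the positions
`c i, …, c (i + 1) - 1` of `s`. -/
def IsDecomposition (φ : Substitution A) (s t : ℤ → A) (c : ℤ → ℤ) : Prop :=
  ∀ i : ℤ, c (i + 1) = c i + ((φ.toFun (t i)).length : ℤ) ∧
    (List.ofFn fun j : Fin (φ.toFun (t i)).length => s (c i + (j : ℕ))) = φ.toFun (t i)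

/-- `φ` is recognisable if every `s ∈ X_φ` can be decomposed in exactly one way into words `φ(tᵢ)`
with `t ∈ X_φ`. The numbering of the words is normalised by letting `φ(t₀)` be the word that covers
position `0` of `s`. -/
def IsRecognisable (φ : Substitution A) : Prop :=
  ∀ s : φ.Subshift, ∃! p : φ.Subshift × (ℤ → ℤ),
    φ.IsDecomposition s.1 p.1.1 p.2 ∧ p.2 0 ≤ 0 ∧ 0 < p.2 1

/-- `φ` is left proper if there is a letter `a` such that every `φ(b)` is `a w` with `w ≠ ε`. -/
def IsLeftProper (φ : Substitution A) : Prop :=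
  ∃ a : A, ∀ b : A, ∃ w : List A, w ≠ [] ∧ φ.toFun b = a :: w

/-- `φ` is pre-left proper if some (positive) power of it is left proper. -/
def IsPreLeftProper (φ : Substitution A) : Prop :=
  ∃ i : ℕ, 0 < i ∧ (φ.pow i).IsLeftProper

/-- The direct limit `lim→ M_φᵀ` of `ℤ^A → ℤ^A → ℤ^A → ⋯`, all maps being multiplication by the
transpose of the substitution matrix. -/
noncomputable abbrev TransposeLimit [Fintype A] (φ : Substitution A) : Type u :=
  Module.DirectLimit (R := ℤ) (ι := ℕ) (fun _ => A → ℤ)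
    (fun i j _ => φ.matrix.transpose.mulVecLin ^ (j - i))

/-! ### Return words and the pre-left properisation -/

/-- The letter `a` is fixed (on the left) of order `k`. -/
def IsFixedLetter (φ : Substitution A) (a : A) (k : ℕ) : Prop :=
  0 < k ∧ ∃ u : List A, φ.iter k [a] = a :: u

/-- `v` is a return word to `a`: `v = a u`, the letter `a` is not in `u`, and `v a` is admitted. -/
def IsReturnWord (φ : Substitution A) (a : A) (v : List A) : Prop :=
  (∃ u : List A, v = a :: u ∧ a ∉ u) ∧ φ.Admitted (v ++ [a])

/-- The set of return words to `a`, as an alphabet. -/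
def ReturnWord (φ : Substitution A) (a : A) : Type u := {v : List A // φ.IsReturnWord a v}

/-- The concatenation in `A*` of a list of return words. -/
def concat (φ : Substitution A) (a : A) (ws : List (φ.ReturnWord a)) : List A :=
  (ws.map fun v => v.1).flatten

theorem concat_nil (φ : Substitution A) (a : A) : φ.concat a [] = [] := rfl

theorem concat_cons (φ : Substitution A) (a : A) (v : φ.ReturnWord a)
    (ws : List (φ.ReturnWord a)) : φ.concat a (v :: ws) = v.1 ++ φ.concat a ws := rfl

theorem exists_returnWord (φ : Substitution A) {a : A} {u : List A} (hu : a ∉ u)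
    (h : φ.Admitted ((a :: u) ++ [a])) : ∃ v : φ.ReturnWord a, v.1 = a :: u :=
  ⟨⟨a :: u, ⟨u, rfl, hu⟩, h⟩, rfl⟩

theorem exists_concat_eq (φ : Substitution A) (a : A) (n : ℕ) :
    ∀ t : List A, t.length ≤ n → φ.Admitted ((a :: t) ++ [a]) →
      ∃ ws : List (φ.ReturnWord a), φ.concat a ws = a :: t := by
  induction n with
  | zero =>
    intro t ht hadm
    obtain rfl : t = [] := List.length_eq_zero_iff.mp (Nat.le_zero.mp ht)
    obtain ⟨v, hv⟩ := φ.exists_returnWord List.not_mem_nil hadm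
    exact ⟨[v], by rw [concat_cons, concat_nil, List.append_nil, hv]⟩
  | succ n ih =>
    intro t ht hadm
    by_cases ha : a ∈ t
    · obtain ⟨u, r, rfl, hu⟩ := List.eq_append_cons_of_mem ha
      have h1 : φ.Admitted ((a :: r) ++ [a]) := by
        refine hadm.of_infix ⟨a :: u, [], ?_⟩
        simp
      have h2 : φ.Admitted ((a :: u) ++ [a]) := by
        refine hadm.of_infix ⟨[], r ++ [a], ?_⟩
        simp
      have hr : r.length ≤ n := by
        simp only [List.length_append, List.length_cons] at ht
        omega
      obtain ⟨ws, hws⟩ := ih r hr h1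
      obtain ⟨v, hv⟩ := φ.exists_returnWord hu h2
      refine ⟨v :: ws, ?_⟩
      rw [concat_cons, hws, hv]
      simp
    · obtain ⟨v, hv⟩ := φ.exists_returnWord ha hadm
      exact ⟨[v], by rw [concat_cons, concat_nil, List.append_nil, hv]⟩

/-- If `a` is fixed of order `k` and `v` is a return word to `a`, then `φᵏ(v)` is a concatenation
of return words to `a`. -/
theorem exists_decomposition (φ : Substitution A) {a : A} {k : ℕ} (h : φ.IsFixedLetter a k)
    (v : φ.ReturnWord a) :
    ∃ ws : List (φ.ReturnWord a), φ.concat a ws = φ.iter k v.1 := by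
  obtain ⟨v, ⟨u, rfl, hu⟩, hadm⟩ := v
  obtain ⟨-, x, hx⟩ := h
  have e : φ.iter k (a :: u) = a :: (x ++ φ.iter k u) := by
    have := φ.iter_append k [a] u
    rw [hx] at this
    simpa using this
  have h1 : φ.Admitted (φ.iter k (a :: u) ++ [a]) := by
    refine (hadm.iter k).of_infix ⟨[], x, ?_⟩
    rw [iter_append, hx]
    simp
  show ∃ ws : List (φ.ReturnWord a), φ.concat a ws = φ.iter k (a :: u)
  rw [e] at h1 ⊢
  exact φ.exists_concat_eq a _ _ le_rfl h1

/-- The pre-left properisation `ψ` of `φ` with respect to a letter `a` fixed of order `k`: the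
substitution on the alphabet of return words to `a` which sends a return word `v` to the
decomposition of `φᵏ(v)` into return words. (The decomposition is unique, since a return word
contains `a` exactly once, in first place.) -/
noncomputable def preLeftProperisation (φ : Substitution A) (a : A) (k : ℕ)
    (h : φ.IsFixedLetter a k) : Substitution (φ.ReturnWord a) where
  toFun v := (φ.exists_decomposition h v).choose
  ne_nil v hv := by
    have hs := (φ.exists_decomposition h v).choose_spec
    rw [hv] at hs
    obtain ⟨⟨u, hu, -⟩, -⟩ := v.2
    exact φ.iter_ne_nil k (w := v.1) (by rw [hu]; simp) hs.symm

end Substitution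

/-! ### Čech cohomology with integer coefficients -/

/-- An open cover of `X`: a set of open subsets with union `X`. -/
structure OpenCover (X : Type u) [TopologicalSpace X] where
  /-- the members of the cover -/
  sets : Set (Opens X)
  covers : ∀ x : X, ∃ U ∈ sets, x ∈ U

namespace OpenCover

variable {X : Type u} [TopologicalSpace X]

/-- The (ordered) `n`-simplices of the nerve: `(n + 1)`-tuples of members of the cover with
non-empty intersection. -/
def Simplex (𝒰 : OpenCover X) (n : ℕ) : Type u :=
  {s : Fin (n + 1) → 𝒰.sets // ∃ x : X, ∀ i, x ∈ (s i).1}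

/-- The `j`-th face of a simplex. -/
def Simplex.face {𝒰 : OpenCover X} {n : ℕ} (s : 𝒰.Simplex (n + 1)) (j : Fin (n + 2)) :
    𝒰.Simplex n :=
  ⟨fun i => s.1 (j.succAbove i), s.2.imp fun _ hx _ => hx _⟩

/-- Integer `n`-cochains of the nerve. -/
abbrev Cochain (𝒰 : OpenCover X) (n : ℕ) : Type u := 𝒰.Simplex n → ℤ

/-- The coboundary `(d f)(s) = ∑ⱼ (-1)ʲ f(∂ⱼ s)`. -/
def d (𝒰 : OpenCover X) (n : ℕ) : 𝒰.Cochain n →ₗ[ℤ] 𝒰.Cochain (n + 1) where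
  toFun f s := ∑ j : Fin (n + 2), (-1) ^ (j : ℕ) * f (s.face j)
  map_add' f g := by
    funext s
    simp [mul_add, Finset.sum_add_distrib]
  map_smul' m f := by
    funext s
    simp [Finset.mul_sum, mul_left_comm]

/-- The `n`-cocycles. -/
def cocycles (𝒰 : OpenCover X) (n : ℕ) : Submodule ℤ (𝒰.Cochain n) := LinearMap.ker (𝒰.d n)

/-- The `n`-coboundaries. -/
def coboundaries (𝒰 : OpenCover X) : (n : ℕ) → Submodule ℤ (𝒰.Cochain n)
  | 0 => ⊥
  | n + 1 => LinearMap.range (𝒰.d n)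

/-- The cohomology `Hⁿ(𝒰; ℤ)` of the nerve of the cover `𝒰`: cocycles modulo coboundaries. -/
abbrev Cohomology (𝒰 : OpenCover X) (n : ℕ) : Type u :=
  𝒰.cocycles n ⧸ (𝒰.coboundaries n).submoduleOf (𝒰.cocycles n)

/-- Covers are directed by refinement: `𝒰 ≤ 𝒱` if every member of `𝒱` lies in a member of `𝒰`. -/
instance : Preorder (OpenCover X) where
  le 𝒰 𝒱 := ∀ V : 𝒱.sets, ∃ U : 𝒰.sets, V.1 ≤ U.1
  le_refl _ V := ⟨V, le_rfl⟩
  le_trans _ _ _ h₁ h₂ W :=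
    let ⟨V, hV⟩ := h₂ W
    let ⟨U, hU⟩ := h₁ V
    ⟨U, hV.trans hU⟩

section Refinement

variable {𝒰 𝒱 : OpenCover X} (r : 𝒱.sets → 𝒰.sets) (hr : ∀ V, V.1 ≤ (r V).1)

/-- The simplicial map of nerves given by a refinement map. -/
def Simplex.map {n : ℕ} (s : 𝒱.Simplex n) : 𝒰.Simplex n :=
  ⟨fun i => r (s.1 i), s.2.imp fun _ hx i => hr _ (hx i)⟩

/-- The map on cochains given by a refinement map. -/
def cochainMap (n : ℕ) : 𝒰.Cochain n →ₗ[ℤ] 𝒱.Cochain n where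
  toFun f s := f (s.map r hr)
  map_add' _ _ := rfl
  map_smul' _ _ := rfl

theorem d_cochainMap (n : ℕ) (f : 𝒰.Cochain n) :
    𝒱.d n (cochainMap r hr n f) = cochainMap r hr (n + 1) (𝒰.d n f) := rfl

theorem cochainMap_mem_cocycles (n : ℕ) :
    ∀ f ∈ 𝒰.cocycles n, cochainMap r hr n f ∈ 𝒱.cocycles n := by
  intro f hf
  have hf' : 𝒰.d n f = 0 := hf
  show 𝒱.d n _ = 0
  rw [d_cochainMap, hf', map_zero]

theorem cochainMap_mem_coboundaries (n : ℕ) :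
    ∀ f ∈ 𝒰.coboundaries n, cochainMap r hr n f ∈ 𝒱.coboundaries n := by
  intro f hf
  cases n with
  | zero =>
    have hf' : f = 0 := hf
    rw [hf', map_zero]
    exact Submodule.zero_mem _
  | succ n =>
    obtain ⟨g, rfl⟩ := hf
    exact ⟨cochainMap r hr n g, d_cochainMap r hr n g⟩

/-- The map on cohomology given by a refinement map. -/
def cohomologyMap (n : ℕ) : 𝒰.Cohomology n →ₗ[ℤ] 𝒱.Cohomology n :=
  Submodule.mapQ _ _ ((cochainMap r hr n).restrict (cochainMap_mem_cocycles r hr n))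
    (fun f hf => cochainMap_mem_coboundaries r hr n f.1 hf)

end Refinement

/-- The map `Hⁿ(𝒰; ℤ) → Hⁿ(𝒱; ℤ)` for a cover `𝒱` refining `𝒰`. It is given by any choice of a
refinement map (different choices induce the same map on cohomology). -/
noncomputable def transition (n : ℕ) (𝒰 𝒱 : OpenCover X) (h : 𝒰 ≤ 𝒱) :
    𝒰.Cohomology n →ₗ[ℤ] 𝒱.Cohomology n :=
  cohomologyMap (fun V => (h V).choose) (fun V => (h V).choose_spec) n

end OpenCover

open Classical in
/-- The `n`-th Čech cohomology group `Ȟⁿ(X) = Ȟⁿ(X; ℤ)`: the direct limit of the cohomology of the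
nerves of all open covers of `X`. -/
noncomputable abbrev CechCohomology (n : ℕ) (X : Type u) [TopologicalSpace X] : Type u :=
  Module.DirectLimit (R := ℤ) (ι := OpenCover X) (fun 𝒰 => 𝒰.Cohomology n)
    (OpenCover.transition n)

/-! The tiling space is the suspension of the shift `σ` on a compact zero-dimensional space `X`.
Pulled back to the cylinder `X × [0, 1]`, every integer Čech 1-cocycle becomes trivial. Comparing
its trivialising functions at the glued points `(s, 0)` and `(σ s, 1)` gives a continuous function
`X → ℤ`, the holonomy, well defined up to functions `h - h ∘ σ`. Every continuous function is a
holonomy, and a cocycle whose holonomy is a coboundary dies on a refinement. So the first Čech group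
is the group of coinvariants (`cechHolonomy_bijective`).

By primitivity the letter `a` occurs with bounded gaps, so there are finitely many return words.
Cutting a sequence at the occurrences of `a` is the only way to write it in return words. Hence
`X_φ` is partitioned into towers over `X_ψ` (`concatMap_isRecognisable`), and summing over the
levels of the towers is an isomorphism on coinvariants (`IsPartition.coinvTransfer_bijective`). This
is the second claim. For the first, some `φ^(kn)(a)` begins with `a u a` where `u` avoids `a`; as
return words begin with `a`, all words `ψⁿ(v)` begin with the return word `a u`.

For the third, recognisability makes the transfer of `φ` bijective by the same tower argument.
Concatenation intertwines `ψ` with `φᵏ`, so the transfer `p` of `ψ` is bijective too. On functions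
of the letter at position `0`, `p` acts as `M_ψᵀ`. Since a power of `ψ` is left proper, high powers
of `ψ` send all sequences to sequences with the same long beginning at the origin. Therefore some
`pⁿ` carries a given class to that of a letter function (`exists_transfer_eq`), and a letter
function that is a coboundary is killed by a power of `M_ψᵀ` (`exists_pow_eq_zero`). The maps `p⁻ⁿ`
on letter functions then assemble to an isomorphism from the direct limit. -/

namespace OpenCover

/-! ### Nerves in degrees zero and one -/

variable {Y : Type u} [TopologicalSpace Y] {𝒰 𝒱 : OpenCover Y}

/-- The edge of the nerve spanned by two members of a cover with a common point. -/
def edge (U V : 𝒰.sets) (h : ∃ y, y ∈ U.1 ∧ y ∈ V.1) : 𝒰.Simplex 1 :=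
  ⟨![U, V], h.imp fun _ hy i => by fin_cases i; exacts [hy.1, hy.2]⟩

/-- The vertex of the nerve given by a non-empty member of a cover. -/
def vertex (U : 𝒰.sets) (h : ∃ y, y ∈ U.1) : 𝒰.Simplex 0 :=
  ⟨fun _ => U, h.imp fun _ hy _ => hy⟩

theorem Simplex.eq_edge (s : 𝒰.Simplex 1) :
    s = edge (s.1 0) (s.1 1) (s.2.imp fun _ hy => ⟨hy 0, hy 1⟩) := by
  apply Subtype.ext
  funext i
  fin_cases i <;> rfl

open Classical in
/-- The value of a `1`-cochain on a pair of members of the cover, zero if they are disjoint. -/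
noncomputable def pairVal (f : 𝒰.Cochain 1) (U V : 𝒰.sets) : ℤ :=
  if h : ∃ y, y ∈ U.1 ∧ y ∈ V.1 then f (edge U V h) else 0

theorem pairVal_of_mem (f : 𝒰.Cochain 1) {U V : 𝒰.sets} {y : Y} (hU : y ∈ U.1) (hV : y ∈ V.1) :
    pairVal f U V = f (edge U V ⟨y, hU, hV⟩) :=
  dif_pos ⟨y, hU, hV⟩

theorem pairVal_apply (f : 𝒰.Cochain 1) (s : 𝒰.Simplex 1) :
    pairVal f (s.1 0) (s.1 1) = f s := by
  obtain ⟨y, hy⟩ := s.2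
  rw [pairVal_of_mem f (hy 0) (hy 1)]
  exact congrArg f s.eq_edge.symm

theorem pairVal_add (f f' : 𝒰.Cochain 1) (U V : 𝒰.sets) :
    pairVal (f + f') U V = pairVal f U V + pairVal f' U V := by
  unfold pairVal
  split_ifs <;> simp

theorem pairVal_smul (m : ℤ) (f : 𝒰.Cochain 1) (U V : 𝒰.sets) :
    pairVal (m • f) U V = m * pairVal f U V := by
  unfold pairVal
  split_ifs <;> simp

theorem d_zero_apply (b : 𝒰.Cochain 0) (s : 𝒰.Simplex 1) :
    𝒰.d 0 b s = b (s.face 0) - b (s.face 1) := by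
  simp [d, Fin.sum_univ_two, sub_eq_add_neg]

theorem d_one_apply (f : 𝒰.Cochain 1) (s : 𝒰.Simplex (1 + 1)) :
    𝒰.d 1 f s = f (s.face 0) - f (s.face 1) + f (s.face 2) := by
  simp [d, Fin.sum_univ_three, sub_eq_add_neg]

theorem pairVal_cocycle {f : 𝒰.Cochain 1} (hf : f ∈ 𝒰.cocycles 1) {U V W : 𝒰.sets} {y : Y}
    (hU : y ∈ U.1) (hV : y ∈ V.1) (hW : y ∈ W.1) :
    pairVal f U W - pairVal f U V = pairVal f V W := by
  have hs : ∃ y : Y, ∀ i, y ∈ ((![U, V, W] : Fin 3 → 𝒰.sets) i).1 :=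
    ⟨y, fun i => by fin_cases i; exacts [hU, hV, hW]⟩
  let s : 𝒰.Simplex (1 + 1) := ⟨![U, V, W], hs⟩
  have h : 𝒰.d 1 f s = 0 := congrFun (show 𝒰.d 1 f = 0 from hf) s
  rw [d_one_apply] at h
  have e0 : pairVal f V W = f (s.face 0) := pairVal_apply f (s.face 0)
  have e1 : pairVal f U W = f (s.face 1) := pairVal_apply f (s.face 1)
  have e2 : pairVal f U V = f (s.face 2) := pairVal_apply f (s.face 2)
  linarith

theorem mem_cocycles_of_pairVal {f : 𝒰.Cochain 1}
    (h : ∀ (U V W : 𝒰.sets) (y : Y), y ∈ U.1 → y ∈ V.1 → y ∈ W.1 →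
      pairVal f U W - pairVal f U V = pairVal f V W) : f ∈ 𝒰.cocycles 1 := by
  show 𝒰.d 1 f = 0
  funext s
  obtain ⟨y, hy⟩ := s.2
  have e := h _ _ _ y (hy 0) (hy 1) (hy 2)
  rw [d_one_apply, ← pairVal_apply f (s.face 0), ← pairVal_apply f (s.face 1),
    ← pairVal_apply f (s.face 2)]
  have e' : pairVal f ((s.face 1).1 0) ((s.face 1).1 1)
    - pairVal f ((s.face 2).1 0) ((s.face 2).1 1)
    = pairVal f ((s.face 0).1 0) ((s.face 0).1 1) := e
  simp only [Pi.zero_apply]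
  linarith

theorem pairVal_d (b : 𝒰.Cochain 0) {U V : 𝒰.sets} {y : Y} (hU : y ∈ U.1) (hV : y ∈ V.1) :
    pairVal (𝒰.d 0 b) U V = b (vertex V ⟨y, hV⟩) - b (vertex U ⟨y, hU⟩) := by
  rw [pairVal_of_mem _ hU hV, d_zero_apply]
  congr 2 <;> exact Subtype.ext (funext fun i => by fin_cases i; rfl)

theorem mem_coboundaries_of_pairVal {f : 𝒰.Cochain 1} (b : 𝒰.sets → ℤ)
    (h : ∀ (U V : 𝒰.sets) (y : Y), y ∈ U.1 → y ∈ V.1 → pairVal f U V = b V - b U) :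
    f ∈ 𝒰.coboundaries 1 := by
  refine ⟨fun s => b (s.1 0), ?_⟩
  funext s
  obtain ⟨y, hy⟩ := s.2
  rw [d_zero_apply, ← pairVal_apply f s, h _ _ y (hy 0) (hy 1)]
  rfl

theorem pairVal_cochainMap (r : 𝒱.sets → 𝒰.sets) (hr : ∀ V, V.1 ≤ (r V).1) (f : 𝒰.Cochain 1)
    {U V : 𝒱.sets} {y : Y} (hU : y ∈ U.1) (hV : y ∈ V.1) :
    pairVal (cochainMap r hr 1 f) U V = pairVal f (r U) (r V) := by
  rw [pairVal_of_mem _ hU hV, pairVal_of_mem _ (hr _ hU) (hr _ hV)]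
  show f _ = f _
  congr 1
  exact Subtype.ext (funext fun i => by fin_cases i <;> rfl)

instance : Nonempty (OpenCover Y) := ⟨⟨{⊤}, fun _ => ⟨⊤, rfl, trivial⟩⟩⟩

instance : IsDirectedOrder (OpenCover Y) where
  directed 𝒰 𝒱 := by
    refine ⟨⟨{W | (∃ U ∈ 𝒰.sets, W ≤ U) ∧ ∃ V ∈ 𝒱.sets, W ≤ V}, fun y => ?_⟩, fun W => ?_,
      fun W => ?_⟩
    · obtain ⟨U, hU, hyU⟩ := 𝒰.covers y
      obtain ⟨V, hV, hyV⟩ := 𝒱.covers y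
      exact ⟨U ⊓ V, ⟨⟨U, hU, inf_le_left⟩, V, hV, inf_le_right⟩, hyU, hyV⟩
    · obtain ⟨U, hU, h⟩ := W.2.1
      exact ⟨⟨U, hU⟩, h⟩
    · obtain ⟨V, hV, h⟩ := W.2.2
      exact ⟨⟨V, hV⟩, h⟩

/-! ### Trivialising pulled-back cocycles over a set -/

section Trivialisation

variable {Z : Type*} [TopologicalSpace Z]

/-- `g` trivialises the pull-back along `π` of the cochain `f` over `S`: the functions `g U` are
continuous on `S ∩ π⁻¹(U)` and differ on overlaps by the values of `f`. -/
def IsTriv (π : Z → Y) (f : 𝒰.Cochain 1) (S : Set Z) (g : 𝒰.sets → Z → ℤ) : Prop :=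
  (∀ p ∈ S, ∀ U V : 𝒰.sets, π p ∈ U.1 → π p ∈ V.1 → g V p - g U p = pairVal f U V) ∧
    ∀ U : 𝒰.sets, ∀ p ∈ S, π p ∈ U.1 → ContinuousWithinAt (g U) S p

theorem IsTriv.mono {π : Z → Y} {f : 𝒰.Cochain 1} {S S' : Set Z} {g : 𝒰.sets → Z → ℤ}
    (h : IsTriv π f S g) (hS : S' ⊆ S) : IsTriv π f S' g :=
  ⟨fun p hp => h.1 p (hS hp), fun U p hp hU => (h.2 U p (hS hp) hU).mono hS⟩

theorem IsTriv.congr {π : Z → Y} {f : 𝒰.Cochain 1} {S : Set Z} {g g' : 𝒰.sets → Z → ℤ}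
    (h : IsTriv π f S g) (hg : ∀ U : 𝒰.sets, ∀ p ∈ S, π p ∈ U.1 → g' U p = g U p)
    (hπ : Continuous π) : IsTriv π f S g' := by
  refine ⟨fun p hp U V hU hV => ?_, fun U p hp hU => ?_⟩
  · rw [hg U p hp hU, hg V p hp hV, h.1 p hp U V hU hV]
  · refine (h.2 U p hp hU).congr_of_eventuallyEq ?_ (hg U p hp hU)
    have : π ⁻¹' U.1 ∈ nhdsWithin p S :=
      mem_nhdsWithin_of_mem_nhds ((U.1.2.preimage hπ).mem_nhds hU)
    filter_upwards [this, self_mem_nhdsWithin] with q hq hqS using hg U q hqS hq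

/-- Closedness of both pieces is what glues continuity: near a point outside a closed piece, that
piece imposes no condition. -/
theorem IsTriv.union {π : Z → Y} {f : 𝒰.Cochain 1} {S S₂ : Set Z} {g : 𝒰.sets → Z → ℤ}
    (h : IsTriv π f S g) (h₂ : IsTriv π f S₂ g) (hS : IsClosed S) (hS₂ : IsClosed S₂) :
    IsTriv π f (S ∪ S₂) g := by
  refine ⟨fun p hp => hp.elim (h.1 p) (h₂.1 p), fun U p _ hU => ?_⟩
  have key : ∀ {R : Set Z}, IsClosed R → IsTriv π f R g → ContinuousWithinAt (g U) R p := by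
    intro R hR hg
    by_cases hp : p ∈ R
    · exact hg.2 U p hp hU
    · have : nhdsWithin p R = ⊥ := by
        rwa [← notMem_closure_iff_nhdsWithin_eq_bot, hR.closure_eq]
      rw [ContinuousWithinAt, this]
      exact Filter.tendsto_bot
  exact (key hS h).union (key hS₂ h₂)

/-- Over a set that is mapped into a member of the cover every cocycle is trivial; here the
trivialisation is normalised by a function `δ`. -/
theorem isTriv_of_subset {π : Z → Y} {f : 𝒰.Cochain 1}
    (hf : f ∈ 𝒰.cocycles 1) {S : Set Z} (U₀ : 𝒰.sets) (hS : ∀ p ∈ S, π p ∈ U₀.1) {δ : Z → ℤ}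
    (hδ : ContinuousOn δ S) : IsTriv π f S fun U p => δ p + pairVal f U₀ U := by
  refine ⟨fun p hp U V hU hV => ?_, fun U p hp hU => ?_⟩
  · rw [← pairVal_cocycle hf (hS p hp) hU hV]
    ring
  · exact (hδ p hp).add continuousWithinAt_const

end Trivialisation

/-! ### Triviality of cocycles on a cylinder -/

section Cylinder

open unitInterval

variable {X : Type*} [TopologicalSpace X]

/-- The strip between times `r` and `r'` lies over the single member `U₀`. There the trivialisation
is prescribed by the value of `g U₀` at time `r`, kept constant in time, so it agrees with the old
one on the common edge. -/
theorem exists_isTriv_step {π : X × I → Y} (hπ : Continuous π) {f : 𝒰.Cochain 1}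
    (hf : f ∈ 𝒰.cocycles 1) {P P' : Set X} (hP : IsClosed P) (hP' : IsClosed P') {r r' : I}
    (hr : r ≤ r') {U₀ : 𝒰.sets} (hU₀ : ∀ p ∈ P' ×ˢ Set.Icc r r', π p ∈ U₀.1)
    {g : 𝒰.sets → X × I → ℤ} (hg : IsTriv π f (P ×ˢ Set.Icc 0 r) g) :
    ∃ g', IsTriv π f ((P ∩ P') ×ˢ Set.Icc 0 r') g' := by
  classical
  refine ⟨fun U p => if p.2 ≤ r then g U p else g U₀ (p.1, r) + pairVal f U₀ U, ?_⟩
  have hsub : (P ∩ P') ×ˢ Set.Icc (0 : I) r' ⊆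
      ((P ∩ P') ×ˢ Set.Icc 0 r) ∪ ((P ∩ P') ×ˢ Set.Icc r r') := by
    rintro ⟨s, x⟩ ⟨hs, hx⟩
    rcases le_total x r with h | h
    · exact Or.inl ⟨hs, hx.1, h⟩
    · exact Or.inr ⟨hs, h, hx.2⟩
  refine IsTriv.mono (IsTriv.union ?_ ?_ ((hP.inter hP').prod isClosed_Icc)
    ((hP.inter hP').prod isClosed_Icc)) hsub
  · refine (hg.mono (Set.prod_mono_left Set.inter_subset_left)).congr ?_ hπ
    rintro U p ⟨-, hp⟩ -
    exact if_pos hp.2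
  · have h1 : ContinuousOn (fun p : X × I => g U₀ (p.1, r)) ((P ∩ P') ×ˢ Set.Icc r r') := by
      rintro p ⟨hp1, hp2⟩
      have hp3 : ((p.1, r) : X × I) ∈ P ×ˢ Set.Icc (0 : I) r :=
        ⟨hp1.1, Set.right_mem_Icc.mpr r.2.1⟩
      have hp4 : π (p.1, r) ∈ U₀.1 := hU₀ _ ⟨hp1.2, Set.left_mem_Icc.mpr hr⟩
      refine ContinuousWithinAt.comp (f := fun p : X × I => ((p.1, r) : X × I))
        (t := P ×ˢ Set.Icc (0 : I) r) (hg.2 U₀ _ hp3 hp4)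
        (by fun_prop) ?_
      rintro q ⟨hq, -⟩
      exact ⟨hq.1, Set.right_mem_Icc.mpr r.2.1⟩
    refine (isTriv_of_subset hf U₀ (fun p hp => hU₀ p ⟨hp.1.2, hp.2⟩) h1).congr ?_ hπ
    rintro U ⟨s, x⟩ ⟨hs, hx⟩ hU
    dsimp only
    split_ifs with h
    · obtain rfl : x = r := le_antisymm h hx.1
      have := hg.1 (s, x) ⟨hs.1, Set.right_mem_Icc.mpr x.2.1⟩ U₀ U
        (hU₀ _ ⟨hs.2, Set.left_mem_Icc.mpr hr⟩) hU
      linarith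
    · rfl

variable [CompactSpace X] [T2Space X] [TotallyDisconnectedSpace X]

/-- A tube argument: subdivide the interval so finely that each strip around `s` maps into one
member of the cover, and extend strip by strip. Each step shrinks the clopen base, but there are
finitely many steps. -/
theorem exists_isTriv_nhds {π : X × I → Y} (hπ : Continuous π) {f : 𝒰.Cochain 1}
    (hf : f ∈ 𝒰.cocycles 1) (s : X) :
    ∃ P : Set X, IsClopen P ∧ s ∈ P ∧ ∃ g, IsTriv π f (P ×ˢ Set.univ) g := by
  let ι := {q : Set X × Set I × 𝒰.sets // IsClopen q.1 ∧ s ∈ q.1 ∧ IsOpen q.2.1 ∧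
    ∀ p ∈ q.1 ×ˢ q.2.1, π p ∈ q.2.2.1}
  have hcov : Set.univ ⊆ ⋃ i : ι, i.1.2.1 := by
    rintro x -
    obtain ⟨U, hU, hx⟩ := 𝒰.covers (π (s, x))
    obtain ⟨a, b, ha, hb, hsa, hxb, hab⟩ :=
      isOpen_prod_iff.mp (U.2.preimage hπ) s x hx
    obtain ⟨P, hP, hsP, hPa⟩ := compact_exists_isClopen_in_isOpen ha hsa
    exact Set.mem_iUnion.mpr ⟨⟨(P, b, ⟨U, hU⟩), hP, hsP, hb,
      fun p hp => hab ⟨hPa hp.1, hp.2⟩⟩, hxb⟩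
  obtain ⟨t, ht0, htm, ⟨n, hn⟩, hc⟩ :=
    exists_monotone_Icc_subset_open_cover_unitInterval (fun i : ι => i.2.2.2.1) hcov
  have key : ∀ m, ∃ P : Set X, IsClopen P ∧ s ∈ P ∧
      ∃ g, IsTriv π f (P ×ˢ Set.Icc 0 (t m)) g := by
    intro m
    induction m with
    | zero =>
      obtain ⟨i, hi⟩ := hc 0
      refine ⟨i.1.1, i.2.1, i.2.2.1, _, isTriv_of_subset hf i.1.2.2 ?_
        (continuousOn_const (c := (0 : ℤ)))⟩
      rintro p ⟨hp1, hp2⟩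
      refine i.2.2.2.2 p ⟨hp1, hi ⟨?_, hp2.2.trans (htm (Nat.le_succ 0))⟩⟩
      rw [ht0]
      exact hp2.1
    | succ m ih =>
      obtain ⟨P, hP, hsP, g, hg⟩ := ih
      obtain ⟨i, hi⟩ := hc m
      obtain ⟨g', hg'⟩ := exists_isTriv_step hπ hf hP.1 i.2.1.1 (htm (Nat.le_succ m))
        (fun p hp => i.2.2.2.2 p ⟨hp.1, hi hp.2⟩) hg
      exact ⟨P ∩ i.1.1, hP.inter i.2.1, ⟨hsP, i.2.2.1⟩, g', hg'⟩
  obtain ⟨P, hP, hsP, g, hg⟩ := key n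
  refine ⟨P, hP, hsP, g, hg.mono (Set.prod_mono_right fun x _ => ?_)⟩
  rw [hn n le_rfl]
  exact ⟨x.2.1, x.2.2⟩

/-- Every cocycle becomes trivial on a cylinder over a compact zero-dimensional space. -/
theorem exists_isTriv {π : X × I → Y} (hπ : Continuous π) {f : 𝒰.Cochain 1}
    (hf : f ∈ 𝒰.cocycles 1) : ∃ g, IsTriv π f Set.univ g := by
  classical
  have key : ∃ C : Set X, IsClopen C ∧ Set.univ ⊆ C ∧ ∃ g, IsTriv π f (C ×ˢ Set.univ) g := by
    refine isCompact_univ.induction_on (p := fun S : Set X => ∃ C : Set X, IsClopen C ∧ S ⊆ C ∧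
      ∃ g, IsTriv π f (C ×ˢ Set.univ) g) ?_ ?_ ?_ ?_
    · refine ⟨∅, isClopen_empty, subset_rfl, fun _ _ => 0, ?_, ?_⟩ <;> simp
    · rintro S S' h ⟨C, hC, hSC, hg⟩
      exact ⟨C, hC, h.trans hSC, hg⟩
    · rintro S S' ⟨C, hC, hSC, g, hg⟩ ⟨C', hC', hSC', g', hg'⟩
      -- The two clopen pieces are disjoint, so the trivialisations over them need no compatibility.
      refine ⟨C ∪ C' \ C, hC.union (hC'.diff hC), ?_,
        fun U p => if p.1 ∈ C then g U p else g' U p, ?_⟩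
      · rw [Set.union_sdiff_self]
        exact Set.union_subset_union hSC hSC'
      · rw [Set.union_prod]
        refine IsTriv.union ?_ ?_ (hC.1.prod isClosed_univ) ((hC'.diff hC).1.prod isClosed_univ)
        · exact hg.congr (fun U p hp _ => if_pos hp.1) hπ
        · exact (hg'.mono (Set.prod_mono_left Set.sdiff_subset)).congr
            (fun U p hp _ => if_neg hp.1.2) hπ
    · intro s _
      obtain ⟨P, hP, hsP, g, hg⟩ := exists_isTriv_nhds hπ hf s
      exact ⟨P, mem_nhdsWithin_of_mem_nhds (hP.2.mem_nhds hsP), P, hP, subset_rfl, g, hg⟩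
  obtain ⟨C, -, hC, g, hg⟩ := key
  exact ⟨g, hg.mono fun p _ => ⟨hC trivial, trivial⟩⟩

end Cylinder

end OpenCover

open unitInterval

/-! ### Coinvariants and suspensions -/

section Coinvariants

variable {X : Type*} [TopologicalSpace X]

/-- The coboundary operator `h ↦ h - h ∘ T`. -/
def dynCoboundary (T : C(X, X)) : C(X, ℤ) →ₗ[ℤ] C(X, ℤ) where
  toFun h := h - h.comp T
  map_add' h h' := by ext; simp; ring
  map_smul' m h := by ext; simp; ring

@[simp] theorem dynCoboundary_apply (T : C(X, X)) (h : C(X, ℤ)) (x : X) :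
    dynCoboundary T h x = h x - h (T x) := rfl

/-- The integer-valued continuous functions modulo the functions `h - h ∘ T`. -/
abbrev Coinvariants (T : C(X, X)) : Type _ := C(X, ℤ) ⧸ LinearMap.range (dynCoboundary T)

end Coinvariants

/-! ### Holonomy of cocycles on a suspension -/

section Suspension

variable {X : Type u} [TopologicalSpace X]

/-- The relation `(s, 0) ∼ (T s, 1)`. -/
def SuspensionRel (T : X ≃ₜ X) (p q : X × I) : Prop := p.2 = 0 ∧ q = (T p.1, 1)

/-- The suspension of a homeomorphism. -/
def Suspension (T : X ≃ₜ X) : Type u := Quot (SuspensionRel T)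

instance (T : X ≃ₜ X) : TopologicalSpace (Suspension T) :=
  inferInstanceAs (TopologicalSpace (Quot (SuspensionRel T)))

namespace Suspension

variable {T : X ≃ₜ X}

/-- The quotient map. -/
def proj (T : X ≃ₜ X) (p : X × I) : Suspension T := Quot.mk _ p

theorem continuous_proj : Continuous (proj T) := continuous_quot_mk

theorem proj_surjective : Function.Surjective (proj T) := Quot.mk_surjective

theorem proj_glue (s : X) : proj T (s, 0) = proj T (T s, 1) := Quot.sound ⟨rfl, rfl⟩

/-- An open set of the suspension from an open set of the cylinder that is compatible with the
gluing. -/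
def opens (Q : X × I → Prop) (hQ : ∀ s, Q (s, 0) ↔ Q (T s, 1)) (ho : IsOpen {p | Q p}) :
    Opens (Suspension T) :=
  ⟨{y | Quot.lift Q (by rintro ⟨s, x⟩ _ ⟨hx, rfl⟩; cases hx; exact propext (hQ s)) y},
    isOpen_coinduced.mpr ho⟩

open OpenCover

variable {𝒰 𝒱 : OpenCover (Suspension T)}

/-- `F` is the holonomy of the `1`-cochain `f` along the flow lines. -/
def IsHolonomy (f : 𝒰.Cochain 1) (F : C(X, ℤ)) : Prop :=
  ∃ g, IsTriv (proj T) f Set.univ g ∧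
    ∀ s, ∀ U : 𝒰.sets, proj T (s, 0) ∈ U.1 → F s = g U (s, 0) - g U (T s, 1)

/-- Since `(s, 0)` and `(T s, 1)` are the same point of the suspension, changing `U` shifts both
values of `g` by the same number. The difference is therefore independent of `U`, and locally given
by a fixed `U`, hence continuous. -/
theorem exists_isHolonomy [CompactSpace X] [T2Space X] [TotallyDisconnectedSpace X]
    {f : 𝒰.Cochain 1} (hf : f ∈ 𝒰.cocycles 1) : ∃ F, IsHolonomy f F := by
  obtain ⟨g, hg⟩ := exists_isTriv (continuous_proj (T := T)) hf
  have hU : ∀ s : X, ∃ U : 𝒰.sets, proj T (s, 0) ∈ U.1 := fun s =>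
    let ⟨U, hU, h⟩ := 𝒰.covers (proj T (s, 0))
    ⟨⟨U, hU⟩, h⟩
  choose u hu using hU
  have key : ∀ s, ∀ U : 𝒰.sets, proj T (s, 0) ∈ U.1 →
      g (u s) (s, 0) - g (u s) (T s, 1) = g U (s, 0) - g U (T s, 1) := by
    intro s U hU
    have h0 := hg.1 (s, 0) trivial U (u s) hU (hu s)
    have h1 := hg.1 (T s, 1) trivial U (u s) (proj_glue s ▸ hU) (proj_glue s ▸ hu s)
    linarith
  refine ⟨⟨fun s => g (u s) (s, 0) - g (u s) (T s, 1), ?_⟩, g, hg, key⟩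
  refine continuous_iff_continuousAt.mpr fun s => ?_
  have h0 : ContinuousAt (g (u s)) (s, 0) :=
    continuousWithinAt_univ _ _ |>.mp (hg.2 (u s) (s, 0) trivial (hu s))
  have h1 : ContinuousAt (g (u s)) (T s, 1) :=
    continuousWithinAt_univ _ _ |>.mp (hg.2 (u s) (T s, 1) trivial (proj_glue s ▸ hu s))
  have hc : ContinuousAt (fun r : X => g (u s) (r, 0) - g (u s) (T r, 1)) s :=
    ContinuousAt.sub (ContinuousAt.comp (f := fun r : X => ((r, 0) : X × I)) h0 (by fun_prop))
      (ContinuousAt.comp (f := fun r : X => ((T r, 1) : X × I)) h1 (by fun_prop))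
  refine hc.congr ?_
  have : {r : X | proj T (r, 0) ∈ (u s).1} ∈ nhds s :=
    ((u s).1.2.preimage (continuous_proj.comp (by fun_prop : Continuous fun r : X =>
      ((r, 0) : X × I)))).mem_nhds (hu s)
  filter_upwards [this] with r hr using (key r (u s) hr).symm

theorem IsHolonomy.add {f f' : 𝒰.Cochain 1} {F F' : C(X, ℤ)} (h : IsHolonomy f F)
    (h' : IsHolonomy f' F') : IsHolonomy (f + f') (F + F') := by
  obtain ⟨g, hg, hF⟩ := h
  obtain ⟨g', hg', hF'⟩ := h'
  refine ⟨fun U p => g U p + g' U p, ⟨fun p hp U V hU hV => ?_, fun U p hp hU =>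
    (hg.2 U p hp hU).add (hg'.2 U p hp hU)⟩, fun s U hU => ?_⟩
  · rw [pairVal_add, ← hg.1 p hp U V hU hV, ← hg'.1 p hp U V hU hV]
    ring
  · rw [ContinuousMap.add_apply, hF s U hU, hF' s U hU]
    ring

theorem IsHolonomy.smul {f : 𝒰.Cochain 1} {F : C(X, ℤ)} (m : ℤ) (h : IsHolonomy f F) :
    IsHolonomy (m • f) (m • F) := by
  obtain ⟨g, hg, hF⟩ := h
  refine ⟨fun U p => m * g U p, ⟨fun p hp U V hU hV => ?_, fun U p hp hU =>
    continuousWithinAt_const.mul (hg.2 U p hp hU)⟩, fun s U hU => ?_⟩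
  · rw [pairVal_smul, ← hg.1 p hp U V hU hV]
    ring
  · rw [ContinuousMap.smul_apply, hF s U hU, smul_eq_mul]
    ring

/-- For the zero cochain the local functions agree on overlaps and glue to a continuous integer
function on the cylinder. It is constant along each interval, and its restriction to time `0` is the
required primitive. -/
theorem IsHolonomy.mem_range_of_zero {F : C(X, ℤ)} (h : IsHolonomy (0 : 𝒰.Cochain 1) F) :
    F ∈ LinearMap.range (dynCoboundary (T : C(X, X))) := by
  obtain ⟨g, hg, hF⟩ := h
  have hU : ∀ p : X × I, ∃ U : 𝒰.sets, proj T p ∈ U.1 := fun p =>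
    let ⟨U, hU, h⟩ := 𝒰.covers (proj T p)
    ⟨⟨U, hU⟩, h⟩
  choose u hu using hU
  have key : ∀ p, ∀ U : 𝒰.sets, proj T p ∈ U.1 → g (u p) p = g U p := by
    intro p U hU
    have := hg.1 p trivial U (u p) hU (hu p)
    have h0 : pairVal (0 : 𝒰.Cochain 1) U (u p) = 0 := by
      unfold pairVal
      split_ifs <;> rfl
    linarith
  have hc : Continuous fun p => g (u p) p := by
    refine continuous_iff_continuousAt.mpr fun p => ?_
    refine (continuousWithinAt_univ _ _ |>.mp (hg.2 (u p) p trivial (hu p))).congr ?_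
    filter_upwards [((u p).1.2.preimage continuous_proj).mem_nhds (hu p)] with q hq
      using (key q (u p) hq).symm
  have hconst : ∀ (s : X) (x : I), g (u (s, x)) (s, x) = g (u (s, 0)) (s, 0) := fun s x =>
    PreconnectedSpace.constant inferInstance
      (hc.comp (by fun_prop : Continuous fun x : I => ((s, x) : X × I)))
  refine ⟨⟨fun s => g (u (s, 0)) (s, 0), hc.comp (by fun_prop :
    Continuous fun s : X => ((s, 0) : X × I))⟩, ?_⟩
  ext s
  have h1 := hF s (u (s, 0)) (hu _)
  have h2 := key (T s, 1) (u (s, 0)) (proj_glue s ▸ hu (s, 0))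
  rw [h1, ← h2, hconst (T s) 1]
  rfl

theorem IsHolonomy.unique {f : 𝒰.Cochain 1} {F F' : C(X, ℤ)} (h : IsHolonomy f F)
    (h' : IsHolonomy f F') : F - F' ∈ LinearMap.range (dynCoboundary (T : C(X, X))) := by
  have := h.add (h'.smul (-1))
  rw [neg_one_smul, neg_one_smul, add_neg_cancel, ← sub_eq_add_neg] at this
  exact this.mem_range_of_zero

theorem IsHolonomy.map {f : 𝒰.Cochain 1} {F : C(X, ℤ)} (h : IsHolonomy f F)
    (r : 𝒱.sets → 𝒰.sets) (hr : ∀ V, V.1 ≤ (r V).1) :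
    IsHolonomy (cochainMap r hr 1 f) F := by
  obtain ⟨g, hg, hF⟩ := h
  refine ⟨fun V => g (r V), ⟨fun p hp U V hU hV => ?_, fun U p hp hU =>
    hg.2 _ p hp (hr U hU)⟩, fun s U hU => hF s _ (hr U hU)⟩
  rw [pairVal_cochainMap r hr f hU hV]
  exact hg.1 p hp _ _ (hr U hU) (hr V hV)

theorem isHolonomy_of_mem_coboundaries {f : 𝒰.Cochain 1} (hf : f ∈ 𝒰.coboundaries 1) :
    IsHolonomy f 0 := by
  classical
  obtain ⟨b, rfl⟩ := hf
  refine ⟨fun U _ => if h : ∃ y, y ∈ U.1 then b (vertex U h) else 0,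
    ⟨fun p hp U V hU hV => ?_, fun U p hp hU => continuousWithinAt_const⟩, fun s U hU => ?_⟩
  · have hU' : ∃ y, y ∈ U.1 := ⟨_, hU⟩
    have hV' : ∃ y, y ∈ V.1 := ⟨_, hV⟩
    simp only [pairVal_d b hU hV, dif_pos hU', dif_pos hV']
  · simp

/-- If `F = b - b ∘ T`, the corrected functions `g U - b` are compatible with the gluing. Their
level sets are therefore open sets of the suspension, and on this refinement the cocycle is a
difference of constants. -/
theorem IsHolonomy.exists_refinement {f : 𝒰.Cochain 1} {F : C(X, ℤ)} (h : IsHolonomy f F)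
    (hF : F ∈ LinearMap.range (dynCoboundary (T : C(X, X)))) :
    ∃ 𝒱 : OpenCover (Suspension T), 𝒰 ≤ 𝒱 ∧ ∀ (r : 𝒱.sets → 𝒰.sets) (hr : ∀ V, V.1 ≤ (r V).1),
      cochainMap r hr 1 f ∈ 𝒱.coboundaries 1 := by
  classical
  obtain ⟨b, rfl⟩ := hF
  obtain ⟨g, hg, hF⟩ := h
  have hglue : ∀ s, ∀ U : 𝒰.sets, proj T (s, 0) ∈ U.1 →
      g U (s, 0) - b s = g U (T s, 1) - b (T s) := by
    intro s U hU
    have := hF s U hU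
    rw [dynCoboundary_apply] at this
    have e : (T : C(X, X)) s = T s := rfl
    rw [e] at this
    linarith
  have hcont : ∀ U : 𝒰.sets, ∀ p, proj T p ∈ U.1 → ContinuousAt (fun p => g U p - b p.1) p :=
    fun U p hp => (continuousWithinAt_univ _ _ |>.mp (hg.2 U p trivial hp)).sub (by fun_prop)
  let V : 𝒰.sets → ℤ → Opens (Suspension T) := fun U n =>
    opens (fun p => proj T p ∈ U.1 ∧ g U p - b p.1 = n)
      (fun s => by
        have e := proj_glue (T := T) s
        constructor
        · rintro ⟨h1, h2⟩
          exact ⟨e ▸ h1, (hglue s U h1) ▸ h2⟩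
        · rintro ⟨h1, h2⟩
          have h1' : proj T (s, 0) ∈ U.1 := e.symm ▸ h1
          exact ⟨h1', (hglue s U h1').symm ▸ h2⟩)
      (isOpen_iff_mem_nhds.mpr fun p hp => by
        have h1 := (U.1.2.preimage continuous_proj).mem_nhds hp.1
        have h2 := (hcont U p hp.1).preimage_mem_nhds
          ((isOpen_discrete {n}).mem_nhds hp.2)
        filter_upwards [h1, h2] with q hq1 hq2 using ⟨hq1, hq2⟩)
  refine ⟨⟨Set.range fun q : 𝒰.sets × ℤ => V q.1 q.2, fun y => ?_⟩, ?_, fun r hr => ?_⟩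
  · obtain ⟨p, rfl⟩ := proj_surjective y
    obtain ⟨U, hU, hp⟩ := 𝒰.covers (proj T p)
    exact ⟨_, ⟨(⟨U, hU⟩, g ⟨U, hU⟩ p - b p.1), rfl⟩, hp, rfl⟩
  · rintro ⟨_, ⟨U, n⟩, rfl⟩
    refine ⟨U, fun y hy => ?_⟩
    obtain ⟨p, rfl⟩ := proj_surjective y
    exact hy.1
  -- An arbitrary refinement map may send a level set of `U` to another member of the cover; this
  -- only adds the constant `pairVal f U (r W)`.
  · have hconst : ∀ W : Set.range fun q : 𝒰.sets × ℤ => V q.1 q.2, ∃ n : ℤ, ∀ p,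
        proj T p ∈ W.1 → g (r W) p - b p.1 = n := by
      rintro ⟨_, ⟨U, n⟩, rfl⟩
      refine ⟨n + pairVal f U (r ⟨_, (U, n), rfl⟩), fun p hp => ?_⟩
      have := hg.1 p trivial U (r ⟨_, ⟨U, n⟩, rfl⟩) hp.1 (hr _ hp)
      have h2 : g U p - b p.1 = n := hp.2
      linarith
    choose c hc using hconst
    refine mem_coboundaries_of_pairVal c fun W W' y hW hW' => ?_
    obtain ⟨p, rfl⟩ := proj_surjective y
    rw [pairVal_cochainMap r hr f hW hW', ← hg.1 p trivial _ _ (hr _ hW) (hr _ hW'),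
      ← hc W p hW, ← hc W' p hW']
    ring

/-- Index of the cover used to realise a given holonomy: two boxes away from the gluing locus, and
one box across it for every value of the function. -/
abbrev CoverIndex : Type := Bool ⊕ ℤ

/-- The box with the given index. -/
def box (T : X ≃ₜ X) (F : C(X, ℤ)) : CoverIndex → X × I → Prop
  | Sum.inl true, p => (0 : ℝ) < p.2 ∧ (p.2 : ℝ) < 2 / 3
  | Sum.inl false, p => (1 / 3 : ℝ) < p.2 ∧ (p.2 : ℝ) < 1
  | Sum.inr n, p => ((p.2 : ℝ) < 1 / 3 ∧ F p.1 = n) ∨ ((2 / 3 : ℝ) < p.2 ∧ F (T.symm p.1) = n)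

/-- The trivialising function on the box with the given index. -/
noncomputable def boxFun (F : C(X, ℤ)) : CoverIndex → X × I → ℤ
  | Sum.inl _, _ => 0
  | Sum.inr _, p => open Classical in if (p.2 : ℝ) < 1 / 2 then F p.1 else 0

/-- The difference of the trivialising functions on two boxes. -/
def boxDiff : CoverIndex → CoverIndex → ℤ
  | Sum.inl true, Sum.inr n => n
  | Sum.inr n, Sum.inl true => -n
  | _, _ => 0

theorem box_glue (F : C(X, ℤ)) (i : CoverIndex) (s : X) :
    box T F i (s, 0) ↔ box T F i (T s, 1) := by
  rcases i with (_ | _) | n <;> simp [box] <;> norm_num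

theorem isOpen_box (F : C(X, ℤ)) (i : CoverIndex) : IsOpen {p | box T F i p} := by
  have hF : Continuous fun p : X × I => F p.1 := by fun_prop
  have hF' : Continuous fun p : X × I => F (T.symm p.1) := by fun_prop
  have h2 : Continuous fun p : X × I => (p.2 : ℝ) := by fun_prop
  have hlt : ∀ c : ℝ, IsOpen {p : X × I | (p.2 : ℝ) < c} := fun c => isOpen_Iio.preimage h2
  have hgt : ∀ c : ℝ, IsOpen {p : X × I | c < (p.2 : ℝ)} := fun c => isOpen_Ioi.preimage h2
  rcases i with (_ | _) | n
  · exact (hgt _).inter (hlt _)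
  · exact (hgt _).inter (hlt _)
  · exact ((hlt _).inter ((isOpen_discrete {n}).preimage hF)).union
      ((hgt _).inter ((isOpen_discrete {n}).preimage hF'))

theorem exists_box (F : C(X, ℤ)) (p : X × I) : ∃ i, box T F i p := by
  by_cases h0 : (p.2 : ℝ) < 1 / 3
  · exact ⟨Sum.inr (F p.1), Or.inl ⟨h0, rfl⟩⟩
  · by_cases h1 : (2 / 3 : ℝ) < p.2
    · exact ⟨Sum.inr (F (T.symm p.1)), Or.inr ⟨h1, rfl⟩⟩
    · by_cases h2 : (p.2 : ℝ) < 2 / 3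
      · exact ⟨Sum.inl true, by constructor <;> linarith⟩
      · exact ⟨Sum.inl false, by constructor <;> linarith⟩

theorem boxFun_sub (F : C(X, ℤ)) {i j : CoverIndex} {p : X × I} (hi : box T F i p)
    (hj : box T F j p) : boxFun F j p - boxFun F i p = boxDiff i j := by
  have key : ∀ n, box T F (Sum.inr n) p →
      ((p.2 : ℝ) < 1 / 3 ∧ boxFun F (Sum.inr n) p = n) ∨
        ((2 / 3 : ℝ) < p.2 ∧ boxFun F (Sum.inr n) p = 0) := by
    rintro n (⟨h, hn⟩ | ⟨h, -⟩)
    · exact Or.inl ⟨h, (if_pos (by linarith)).trans hn⟩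
    · exact Or.inr ⟨h, if_neg (by linarith)⟩
  have htrue : ∀ n, box T F (Sum.inr n) p → box T F (Sum.inl true) p →
      boxFun F (Sum.inr n) p = n := by
    rintro n hn ⟨-, h⟩
    rcases key n hn with h' | ⟨h', -⟩
    · exact h'.2
    · linarith
  have hfalse : ∀ n, box T F (Sum.inr n) p → box T F (Sum.inl false) p →
      boxFun F (Sum.inr n) p = 0 := by
    rintro n hn ⟨h, -⟩
    rcases key n hn with ⟨h', -⟩ | h'
    · linarith
    · exact h'.2
  have h0 : ∀ c, boxFun F (Sum.inl c) p = 0 := fun c => rfl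
  rcases i with (_ | _) | n <;> rcases j with (_ | _) | m
  · rfl
  · rfl
  · rw [hfalse m hj hi, h0]; rfl
  · rfl
  · rfl
  · rw [htrue m hj hi, h0]; exact sub_zero m
  · rw [hfalse n hi hj, h0]; rfl
  · rw [htrue n hi hj, h0]; exact zero_sub n
  · exact sub_self _

theorem continuousAt_boxFun (F : C(X, ℤ)) {i : CoverIndex} {p : X × I} (hp : box T F i p) :
    ContinuousAt (boxFun F i) p := by
  have h2 : Continuous fun p : X × I => (p.2 : ℝ) := by fun_prop
  rcases i with c | n
  · exact continuousAt_const
  · rcases hp with ⟨h, -⟩ | ⟨h, -⟩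
    · have hF : ContinuousAt (fun p : X × I => F p.1) p := by fun_prop
      refine hF.congr ?_
      filter_upwards [(isOpen_Iio.preimage h2).mem_nhds h] with q hq
      exact (if_pos (lt_trans hq (by norm_num))).symm
    · refine (continuousAt_const (y := (0 : ℤ))).congr ?_
      filter_upwards [(isOpen_Ioi.preimage h2).mem_nhds h] with q hq
      exact (if_neg (not_lt.mpr (le_trans (by norm_num) (le_of_lt hq)))).symm

/-- The trivialising function is `F` just after the gluing locus and `0` just before it, so the jump
across the locus is `F`. Splitting the box across the locus by the values of `F` makes the overlap
differences constants that depend only on the indices. -/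
theorem exists_cocycle_isHolonomy (T : X ≃ₜ X) (F : C(X, ℤ)) :
    ∃ (𝒰 : OpenCover (Suspension T)) (f : 𝒰.Cochain 1), f ∈ 𝒰.cocycles 1 ∧ IsHolonomy f F := by
  let W : CoverIndex → Opens (Suspension T) := fun i =>
    opens (box T F i) (box_glue F i) (isOpen_box F i)
  let 𝒰 : OpenCover (Suspension T) := ⟨Set.range W, fun y => by
    obtain ⟨p, rfl⟩ := proj_surjective y
    obtain ⟨i, hi⟩ := exists_box (T := T) F p
    exact ⟨_, ⟨i, rfl⟩, hi⟩⟩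
  have hidx : ∀ U : 𝒰.sets, ∃ i, W i = U.1 := fun U => U.2
  choose idx hidx using hidx
  have hbox : ∀ (U : 𝒰.sets) (p : X × I), proj T p ∈ U.1 → box T F (idx U) p := by
    intro U p hp
    rw [← hidx U] at hp
    exact hp
  let f : 𝒰.Cochain 1 := fun s => boxDiff (idx (s.1 0)) (idx (s.1 1))
  have hf : ∀ (p : X × I) (U V : 𝒰.sets), proj T p ∈ U.1 → proj T p ∈ V.1 →
      boxFun F (idx V) p - boxFun F (idx U) p = pairVal f U V := by
    intro p U V hU hV
    rw [pairVal_of_mem f hU hV, boxFun_sub F (hbox U p hU) (hbox V p hV)]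
    rfl
  refine ⟨𝒰, f, mem_cocycles_of_pairVal fun U V W y hU hV hW => ?_,
    fun U => boxFun F (idx U), ⟨fun p _ => hf p, fun U p _ hU =>
      (continuousAt_boxFun F (hbox U p hU)).continuousWithinAt⟩, fun s U hU => ?_⟩
  · obtain ⟨p, rfl⟩ := proj_surjective y
    rw [← hf p U W hU hW, ← hf p U V hU hV, ← hf p V W hV hW]
    ring
  · have h0 := hbox U _ hU
    -- Only the boxes across the gluing locus contain points at time `0`.
    rcases hi : idx U with (_ | _) | n
    · rw [hi] at h0
      exact absurd h0.1 (by norm_num)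
    · rw [hi] at h0
      exact absurd h0.1 (by norm_num)
    · simp only [hi, boxFun]
      norm_num

variable [CompactSpace X] [T2Space X] [TotallyDisconnectedSpace X]

/-- The holonomy on cocycles, with values in the coinvariants. -/
noncomputable def cocycleHolonomy (𝒰 : OpenCover (Suspension T)) :
    𝒰.cocycles 1 →ₗ[ℤ] Coinvariants (T : C(X, X)) where
  toFun f := Submodule.Quotient.mk (exists_isHolonomy f.2).choose
  map_add' f f' := by
    rw [← Submodule.Quotient.mk_add, Submodule.Quotient.eq]
    exact (exists_isHolonomy (f + f').2).choose_spec.unique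
      ((exists_isHolonomy f.2).choose_spec.add (exists_isHolonomy f'.2).choose_spec)
  map_smul' m f := by
    rw [← Submodule.Quotient.mk_smul, Submodule.Quotient.eq]
    exact (exists_isHolonomy (m • f).2).choose_spec.unique
      ((exists_isHolonomy f.2).choose_spec.smul m)

theorem IsHolonomy.cocycleHolonomy_eq {f : 𝒰.cocycles 1} {F : C(X, ℤ)} (h : IsHolonomy f.1 F) :
    cocycleHolonomy 𝒰 f = Submodule.Quotient.mk F :=
  (Submodule.Quotient.eq _).mpr ((exists_isHolonomy f.2).choose_spec.unique h)

/-- The holonomy on the cohomology of the nerve of a cover. -/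
noncomputable def cohomologyHolonomy (𝒰 : OpenCover (Suspension T)) :
    𝒰.Cohomology 1 →ₗ[ℤ] Coinvariants (T : C(X, X)) :=
  Submodule.liftQ _ (cocycleHolonomy 𝒰) fun f hf => by
    rw [LinearMap.mem_ker, (isHolonomy_of_mem_coboundaries hf).cocycleHolonomy_eq]
    rfl

theorem IsHolonomy.cohomologyHolonomy_eq {f : 𝒰.cocycles 1} {F : C(X, ℤ)}
    (h : IsHolonomy f.1 F) :
    cohomologyHolonomy 𝒰 (Submodule.Quotient.mk f) = Submodule.Quotient.mk F :=
  h.cocycleHolonomy_eq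

/-- A trivialisation for the coarse cover, reindexed along the refinement map, trivialises the
refined cocycle with the same holonomy. -/
theorem cohomologyHolonomy_transition (h : 𝒰 ≤ 𝒱) (x : 𝒰.Cohomology 1) :
    cohomologyHolonomy 𝒱 (transition 1 𝒰 𝒱 h x) = cohomologyHolonomy 𝒰 x := by
  obtain ⟨f, rfl⟩ := Submodule.Quotient.mk_surjective _ x
  obtain ⟨F, hF⟩ := exists_isHolonomy f.2
  rw [hF.cohomologyHolonomy_eq]
  exact IsHolonomy.cohomologyHolonomy_eq (f := ⟨_, cochainMap_mem_cocycles _ _ 1 f.1 f.2⟩)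
    (hF.map _ _)

open Classical in
/-- The holonomy on the first Čech cohomology group. -/
noncomputable def cechHolonomy (T : X ≃ₜ X) :
    CechCohomology 1 (Suspension T) →ₗ[ℤ] Coinvariants (T : C(X, X)) :=
  Module.DirectLimit.lift ℤ _ _ _ cohomologyHolonomy
    fun _ _ h x => cohomologyHolonomy_transition h x

theorem cechHolonomy_bijective (T : X ≃ₜ X) : Function.Bijective (cechHolonomy T) := by
  classical
  constructor
  · refine (injective_iff_map_eq_zero _).mpr fun z hz => ?_
    obtain ⟨𝒰, x, rfl⟩ := Module.DirectLimit.exists_of z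
    obtain ⟨f, rfl⟩ := Submodule.Quotient.mk_surjective _ x
    obtain ⟨F, hF⟩ := exists_isHolonomy f.2
    have h0 : (Submodule.Quotient.mk F : Coinvariants (T : C(X, X))) = 0 := by
      rw [← hF.cohomologyHolonomy_eq, ← hz]
      exact (Module.DirectLimit.lift_of _ _ _).symm
    obtain ⟨𝒱, h, h𝒱⟩ := hF.exists_refinement ((Submodule.Quotient.mk_eq_zero _).mp h0)
    rw [← Module.DirectLimit.of_f (hij := h)]
    have : transition 1 𝒰 𝒱 h (Submodule.Quotient.mk f) = 0 :=
      (Submodule.Quotient.mk_eq_zero _).mpr (h𝒱 _ _)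
    rw [this, map_zero]
  · intro y
    obtain ⟨F, rfl⟩ := Submodule.Quotient.mk_surjective _ y
    obtain ⟨𝒰, f, hf, hF⟩ := exists_cocycle_isHolonomy T F
    refine ⟨Module.DirectLimit.of ℤ _ _ _ 𝒰 (Submodule.Quotient.mk ⟨f, hf⟩), ?_⟩
    rw [← IsHolonomy.cohomologyHolonomy_eq (f := ⟨f, hf⟩) hF]
    exact Module.DirectLimit.lift_of _ _ _

/-- The first Čech cohomology group of the suspension of a homeomorphism of a compact
zero-dimensional space is the group of coinvariants. -/
noncomputable def cechEquiv (T : X ≃ₜ X) :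
    CechCohomology 1 (Suspension T) ≃ₗ[ℤ] Coinvariants (T : C(X, X)) :=
  LinearEquiv.ofBijective (cechHolonomy T) (cechHolonomy_bijective T)

end Suspension

end Suspension

/-! ### Tower maps and Kakutani equivalence -/

/-- A tower map from `(Y, S)` to `(X, T)`: a map `base : Y → X` that intertwines `S` with the power
of `T` given by `height`. -/
structure TowerMap {X Y : Type*} [TopologicalSpace X] [TopologicalSpace Y] (S : C(Y, Y))
    (T : C(X, X)) where
  /-- the underlying map -/
  base : C(Y, X)
  /-- the return time -/
  height : C(Y, ℕ)
  iterate_height : ∀ y, T^[height y] (base y) = base (S y)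

namespace TowerMap

variable {X Y Z : Type*} [TopologicalSpace X] [TopologicalSpace Y] [TopologicalSpace Z]
  {S : C(Y, Y)} {T : C(X, X)} {R : C(Z, Z)}

theorem continuous_birkhoffSum_uncurry {M : Type*} [AddCommMonoid M] [TopologicalSpace M]
    [ContinuousAdd M] (T : C(X, X)) (F : C(X, M)) :
    Continuous fun p : ℕ × X => birkhoffSum T F p.1 p.2 := by
  refine continuous_prod_of_discrete_left.mpr fun n => ?_
  simp only [birkhoffSum]
  exact continuous_finsetSum _ fun i _ => F.continuous.comp (T.continuous.iterate i)

/-- The sum of a function over the levels of the tower. -/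
def transfer (P : TowerMap S T) : C(X, ℤ) →ₗ[ℤ] C(Y, ℤ) where
  toFun F := ⟨fun y => birkhoffSum T F (P.height y) (P.base y),
    (continuous_birkhoffSum_uncurry T F).comp (P.height.continuous.prodMk P.base.continuous)⟩
  map_add' F F' := by ext; simp [birkhoffSum, Finset.sum_add_distrib]
  map_smul' m F := by ext; simp [birkhoffSum, Finset.mul_sum]

theorem transfer_apply (P : TowerMap S T) (F : C(X, ℤ)) (y : Y) :
    P.transfer F y = birkhoffSum T F (P.height y) (P.base y) := rfl

theorem birkhoffSum_dynCoboundary (h : C(X, ℤ)) (n : ℕ) (x : X) :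
    birkhoffSum T (dynCoboundary T h) n x = h x - h (T^[n] x) := by
  induction n with
  | zero => simp
  | succ n ih =>
    rw [birkhoffSum_succ, ih, dynCoboundary_apply, Function.iterate_succ_apply']
    ring

/-- The sum over a tower telescopes, and the point reached above the top is the base of the next
tower. -/
theorem transfer_dynCoboundary (P : TowerMap S T) (h : C(X, ℤ)) :
    P.transfer (dynCoboundary T h) = dynCoboundary S (h.comp P.base) := by
  ext y
  rw [transfer_apply, birkhoffSum_dynCoboundary, P.iterate_height]
  rfl

/-- The map induced on coinvariants. -/
def coinvTransfer (P : TowerMap S T) : Coinvariants T →ₗ[ℤ] Coinvariants S :=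
  Submodule.mapQ _ _ P.transfer <| by
    rintro _ ⟨h, rfl⟩
    exact ⟨h.comp P.base, (P.transfer_dynCoboundary h).symm⟩

theorem coinvTransfer_mk (P : TowerMap S T) (F : C(X, ℤ)) :
    P.coinvTransfer (Submodule.Quotient.mk F) = Submodule.Quotient.mk (P.transfer F) := rfl

theorem iterate_birkhoffSum_height (P : TowerMap S T) (n : ℕ) (y : Y) :
    T^[birkhoffSum S P.height n y] (P.base y) = P.base (S^[n] y) := by
  induction n with
  | zero => simp
  | succ n ih =>
    rw [birkhoffSum_succ, add_comm, Function.iterate_add_apply, ih, P.iterate_height,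
      Function.iterate_succ_apply']

theorem birkhoffSum_transfer (P : TowerMap S T) (F : C(X, ℤ)) (n : ℕ) (y : Y) :
    birkhoffSum S (P.transfer F) n y
      = birkhoffSum T F (birkhoffSum S P.height n y) (P.base y) := by
  induction n with
  | zero => simp
  | succ n ih =>
    rw [birkhoffSum_succ, ih, birkhoffSum_succ, birkhoffSum_add, iterate_birkhoffSum_height,
      transfer_apply]

/-- Composition of tower maps. -/
def comp (P : TowerMap S T) (Q : TowerMap R S) : TowerMap R T where
  base := P.base.comp Q.base
  height := ⟨fun z => birkhoffSum S P.height (Q.height z) (Q.base z),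
    (continuous_birkhoffSum_uncurry S P.height).comp
      (Q.height.continuous.prodMk Q.base.continuous)⟩
  iterate_height z := by
    show T^[birkhoffSum S P.height (Q.height z) (Q.base z)] (P.base (Q.base z)) = _
    rw [iterate_birkhoffSum_height, Q.iterate_height]
    rfl

theorem comp_base (P : TowerMap S T) (Q : TowerMap R S) (z : Z) :
    (P.comp Q).base z = P.base (Q.base z) := rfl

theorem comp_height (P : TowerMap S T) (Q : TowerMap R S) (z : Z) :
    (P.comp Q).height z = birkhoffSum S P.height (Q.height z) (Q.base z) := rfl

theorem transfer_comp (P : TowerMap S T) (Q : TowerMap R S) (F : C(X, ℤ)) :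
    (P.comp Q).transfer F = Q.transfer (P.transfer F) := by
  ext z
  rw [transfer_apply, transfer_apply, birkhoffSum_transfer]
  rfl

/-- Every point lies on exactly one level of exactly one tower. -/
def IsPartition (P : TowerMap S T) : Prop :=
  ∀ x, ∃! p : Y × ℕ, p.2 < P.height p.1 ∧ T^[p.2] (P.base p.1) = x

/-- The heights are bounded, so the set of pairs below the height function is compact. It maps
continuously and bijectively onto the Hausdorff space `X`; the inverse is thus continuous and
supplies the tower `b` and the level `l`. -/
theorem IsPartition.exists_coordinates [CompactSpace Y] [T2Space X] {P : TowerMap S T}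
    (hP : P.IsPartition) : ∃ (b : C(X, Y)) (l : C(X, ℕ)),
      (∀ x, l x < P.height (b x) ∧ T^[l x] (P.base (b x)) = x) ∧
      ∀ y n, n < P.height y → b (T^[n] (P.base y)) = y ∧ l (T^[n] (P.base y)) = n := by
  let K : Set (Y × ℕ) := {p | p.2 < P.height p.1}
  have hKc : IsClosed K := by
    have : Continuous fun p : Y × ℕ => (p.2, P.height p.1) := by fun_prop
    exact (isClosed_discrete {q : ℕ × ℕ | q.1 < q.2}).preimage this
  have hK : IsCompact K := by
    have hr : IsCompact (Set.range P.height) := isCompact_range P.height.continuous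
    obtain ⟨m, hm⟩ := hr.finite_of_discrete.bddAbove
    refine (isCompact_univ.prod (Set.finite_Iic m).isCompact).of_isClosed_subset hKc ?_
    rintro ⟨y, n⟩ hn
    exact ⟨trivial, (le_of_lt hn).trans (hm ⟨y, rfl⟩)⟩
  have : CompactSpace K := isCompact_iff_compactSpace.mp hK
  let e : K → X := fun p => T^[p.1.2] (P.base p.1.1)
  have he : Continuous e := by
    have h1 : Continuous fun p : ℕ × X => T^[p.1] p.2 :=
      continuous_prod_of_discrete_left.mpr fun n => T.continuous.iterate n
    exact h1.comp (f := fun p : K => (p.1.2, P.base p.1.1)) (by fun_prop)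
  have hbij : Function.Bijective e := by
    constructor
    · intro p q hpq
      exact Subtype.ext ((hP (e q)).unique ⟨p.2, hpq⟩ ⟨q.2, rfl⟩)
    · intro x
      obtain ⟨p, hp, -⟩ := hP x
      exact ⟨⟨p, hp.1⟩, hp.2⟩
  let E : K ≃ₜ X := Continuous.homeoOfEquivCompactToT2 (f := Equiv.ofBijective e hbij) he
  refine ⟨⟨fun x => (E.symm x).1.1, by fun_prop⟩, ⟨fun x => (E.symm x).1.2, by fun_prop⟩,
    fun x => ⟨(E.symm x).2, E.apply_symm_apply x⟩, fun y n hn => ?_⟩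
  have : E.symm (T^[n] (P.base y)) = ⟨(y, n), hn⟩ := E.symm_apply_apply ⟨(y, n), hn⟩
  exact ⟨congrArg (fun q : K => q.1.1) this, congrArg (fun q : K => q.1.2) this⟩

/-- A tower map whose towers partition the space induces an isomorphism on coinvariants. -/
theorem IsPartition.coinvTransfer_bijective [CompactSpace Y] [T2Space X] {P : TowerMap S T}
    (hP : P.IsPartition) (hpos : ∀ y, 0 < P.height y) :
    Function.Bijective P.coinvTransfer := by
  obtain ⟨b, l, hbl, hlb⟩ := hP.exists_coordinates
  constructor
  · refine (injective_iff_map_eq_zero _).mpr fun x hx => ?_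
    obtain ⟨F, rfl⟩ := Submodule.Quotient.mk_surjective _ x
    rw [coinvTransfer_mk] at hx
    obtain ⟨h, hh⟩ := (Submodule.Quotient.mk_eq_zero _).mp hx
    -- A primitive of the tower sums extends up each tower: start with `h` on the ground level and
    -- subtract the values of `F` met on the way.
    refine (Submodule.Quotient.mk_eq_zero _).mpr
      ⟨⟨fun x => h (b x) - birkhoffSum T F (l x) (P.base (b x)), ?_⟩, ?_⟩
    · exact (h.continuous.comp b.continuous).sub ((continuous_birkhoffSum_uncurry T F).comp
        (l.continuous.prodMk (P.base.continuous.comp b.continuous)))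
    · ext x
      obtain ⟨hlt, hx⟩ := hbl x
      have hT : T x = T^[l x + 1] (P.base (b x)) := by
        rw [Function.iterate_succ_apply', hx]
      show (h (b x) - birkhoffSum T F (l x) (P.base (b x)))
        - (h (b (T x)) - birkhoffSum T F (l (T x)) (P.base (b (T x)))) = F x
      have hs : birkhoffSum T F (l x + 1) (P.base (b x))
          = birkhoffSum T F (l x) (P.base (b x)) + F x := by
        rw [birkhoffSum_succ, hx]
      -- Either `T` climbs one level, or it leaves the top level and lands on the ground level over
      -- `S (b x)`.
      rcases Nat.lt_or_ge (l x + 1) (P.height (b x)) with hc | hc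
      · obtain ⟨h1, h2⟩ := hlb (b x) (l x + 1) hc
        rw [← hT] at h1 h2
        rw [h1, h2, hs]
        ring
      · have hl : l x + 1 = P.height (b x) := le_antisymm hlt hc
        rw [hl, P.iterate_height] at hT
        obtain ⟨h1, h2⟩ := hlb (S (b x)) 0 (hpos _)
        rw [Function.iterate_zero_apply, ← hT] at h1 h2
        have h3 := DFunLike.congr_fun hh (b x)
        rw [dynCoboundary_apply, transfer_apply, ← hl, hs] at h3
        rw [h1, h2, birkhoffSum_zero]
        linarith
  · intro y
    obtain ⟨f, rfl⟩ := Submodule.Quotient.mk_surjective _ y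
    have hg : Continuous fun q : ℕ × ℤ => if q.1 = 0 then q.2 else 0 :=
      continuous_of_discreteTopology
    -- A preimage of `f` puts `f` on the ground level and `0` on the other levels.
    refine ⟨Submodule.Quotient.mk ⟨fun x => if l x = 0 then f (b x) else 0,
      hg.comp (l.continuous.prodMk (f.continuous.comp b.continuous))⟩, ?_⟩
    rw [coinvTransfer_mk]
    congr 1
    ext y
    rw [transfer_apply, birkhoffSum, Finset.sum_eq_single_of_mem 0
      (Finset.mem_range.mpr (hpos y))]
    · obtain ⟨h1, h2⟩ := hlb y 0 (hpos y)
      show (if l _ = 0 then f (b _) else 0) = f y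
      rw [if_pos h2, h1]
    · intro n hn hn0
      obtain ⟨h1, h2⟩ := hlb y n (Finset.mem_range.mp hn)
      show (if l _ = 0 then f (b _) else 0) = 0
      rw [if_neg (by rwa [h2])]

end TowerMap

/-! ### Windows of bi-infinite sequences and decompositions into words -/

section Window

variable {A B C : Type*}

/-- The word of length `n` that starts at position `i` of a bi-infinite sequence. -/
def window (s : ℤ → A) (i : ℤ) (n : ℕ) : List A := List.ofFn fun j : Fin n => s (i + (j : ℕ))

@[simp] theorem length_window (s : ℤ → A) (i : ℤ) (n : ℕ) : (window s i n).length = n := by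
  simp [window]

theorem getElem_window (s : ℤ → A) (i : ℤ) (n j : ℕ) (hj : j < (window s i n).length) :
    (window s i n)[j] = s (i + j) := by
  simp [window]

@[simp] theorem window_zero (s : ℤ → A) (i : ℤ) : window s i 0 = [] := by simp [window]

theorem window_add (s : ℤ → A) (i : ℤ) (m n : ℕ) :
    window s i (m + n) = window s i m ++ window s (i + m) n := by
  refine List.ext_getElem (by simp) fun j h1 h2 => ?_
  rw [getElem_window, List.getElem_append]
  split_ifs with h
  · rw [getElem_window]
  · rw [getElem_window]
    rw [length_window] at h ⊢
    congr 1
    omega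

theorem window_one (s : ℤ → A) (i : ℤ) : window s i 1 = [s i] := by simp [window]

theorem window_succ (s : ℤ → A) (i : ℤ) (n : ℕ) :
    window s i (n + 1) = s i :: window s (i + 1) n := by
  rw [add_comm, window_add, window_one]
  rfl

theorem window_succ' (s : ℤ → A) (i : ℤ) (n : ℕ) :
    window s i (n + 1) = window s i n ++ [s (i + n)] := by
  rw [window_add, window_one]

theorem window_shift (s : ℤ → A) (m i : ℤ) (n : ℕ) :
    window (fun j => s (j + m)) i n = window s (i + m) n := by
  simp only [window]
  congr 1
  funext j
  congr 1
  ring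

theorem window_congr {s s' : ℤ → A} {i : ℤ} {n : ℕ}
    (h : ∀ j, i ≤ j → j < i + n → s j = s' j) : window s i n = window s' i n := by
  simp only [window]
  congr 1
  funext j
  exact h _ (by omega) (by omega)

theorem eq_of_window_eq {s s' : ℤ → A} {i : ℤ} {n : ℕ} (h : window s i n = window s' i n)
    {j : ℤ} (h1 : i ≤ j) (h2 : j < i + n) : s j = s' j := by
  obtain ⟨k, rfl⟩ := Int.le.dest h1
  have hk : k < n := by omega
  have := List.getElem_of_eq h (i := k) (by simpa using hk)
  rwa [getElem_window, getElem_window] at this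

theorem window_infix {s : ℤ → A} {i i' : ℤ} {n n' : ℕ} (h1 : i' ≤ i) (h2 : i + n ≤ i' + n') :
    window s i n <:+: window s i' n' := by
  obtain ⟨k, rfl⟩ := Int.le.dest h1
  obtain ⟨l, rfl⟩ : ∃ l, n' = k + n + l := ⟨n' - (k + n), by omega⟩
  exact ⟨window s i' k, window s (i' + (k + n : ℕ)) l, by rw [window_add, window_add]⟩

/-- The letters of `t`, replaced by words by means of `τ`, make up `s`; the word `τ (t i)` occupies
the positions `c i, …, c (i + 1) - 1`. -/
def IsDecomp (τ : B → List A) (s : ℤ → A) (t : ℤ → B) (c : ℤ → ℤ) : Prop :=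
  ∀ i : ℤ, c (i + 1) = c i + ((τ (t i)).length : ℤ) ∧
    window s (c i) (τ (t i)).length = τ (t i)

namespace IsDecomp

variable {τ : B → List A} {s s' : ℤ → A} {t t' : ℤ → B} {c c' : ℤ → ℤ}

theorem cut_add (h : IsDecomp τ s t c) (i : ℤ) (n : ℕ) :
    c (i + n) = c i + (((window t i n).flatMap τ).length : ℤ) := by
  induction n with
  | zero => simp
  | succ n ih =>
    rw [window_succ', Nat.cast_succ, ← add_assoc, (h _).1, ih]
    simp only [List.flatMap_append, List.flatMap_singleton, List.length_append]
    push_cast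
    ring

theorem window_eq (h : IsDecomp τ s t c) (i : ℤ) (n : ℕ) :
    window s (c i) ((window t i n).flatMap τ).length = (window t i n).flatMap τ := by
  induction n with
  | zero => simp
  | succ n ih =>
    rw [window_succ']
    simp only [List.flatMap_append, List.flatMap_singleton, List.length_append]
    rw [window_add, ih, ← h.cut_add, (h _).2]

theorem shift (h : IsDecomp τ s t c) (m : ℤ) :
    IsDecomp τ (fun n => s (n + m)) t (fun i => c i - m) := fun i => by
  refine ⟨by dsimp only; rw [(h i).1]; ring, ?_⟩
  rw [window_shift, sub_add_cancel, (h i).2]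

theorem reindex (h : IsDecomp τ s t c) (m : ℤ) :
    IsDecomp τ s (fun i => t (i + m)) (fun i => c (i + m)) := fun i => by
  have := h (i + m)
  rwa [add_right_comm] at this

theorem comp {τ' : C → List B} {u : ℤ → C} (h : IsDecomp τ s t c) (h' : IsDecomp τ' t u c') :
    IsDecomp (fun x => (τ' x).flatMap τ) s u (fun i => c (c' i)) := fun i => by
  obtain ⟨h1, h2⟩ := h' i
  refine ⟨?_, ?_⟩
  · show c (c' (i + 1)) = _
    rw [h1, h.cut_add, h2]
  · have := h.window_eq (c' i) (τ' (u i)).length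
    rwa [h2] at this

theorem length_flatMap_ge (hτ : ∀ b, τ b ≠ []) (w : List B) :
    w.length ≤ (w.flatMap τ).length := by
  induction w with
  | nil => simp
  | cons b w ih =>
    have := List.length_pos_iff.mpr (hτ b)
    simp only [List.flatMap_cons, List.length_append, List.length_cons]
    omega

theorem add_le_cut (hτ : ∀ b, τ b ≠ []) (h : IsDecomp τ s t c) (i : ℤ) (n : ℕ) :
    c i + n ≤ c (i + n) := by
  rw [h.cut_add]
  have := length_flatMap_ge hτ (window t i n)
  rw [length_window] at this
  omega

theorem lt_cut_succ (hτ : ∀ b, τ b ≠ []) (h : IsDecomp τ s t c) (i : ℤ) : c i < c (i + 1) := by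
  have := h.add_le_cut hτ i 1
  push_cast at this
  omega

theorem strictMono (hτ : ∀ b, τ b ≠ []) (h : IsDecomp τ s t c) : StrictMono c :=
  strictMono_int_of_lt_succ fun i => h.lt_cut_succ hτ i

theorem exists_index (hτ : ∀ b, τ b ≠ []) (h : IsDecomp τ s t c) (n : ℤ) :
    ∃ i, c i ≤ n ∧ n < c (i + 1) := by
  obtain ⟨i, hi, hmax⟩ := Int.exists_greatest_of_bdd (P := fun i => c i ≤ n)
    ⟨|n - c 0|, fun z hz => by
      by_contra hlt
      push Not at hlt
      obtain ⟨k, rfl⟩ : ∃ k : ℕ, z = k := ⟨z.toNat, by have := abs_nonneg (n - c 0); omega⟩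
      have h1 := h.add_le_cut hτ 0 k
      rw [zero_add] at h1
      have := le_abs_self (n - c 0)
      omega⟩
    ⟨-|n - c 0|, by
      have h1 := h.add_le_cut hτ (-|n - c 0|) (n - c 0).natAbs
      rw [Int.natCast_natAbs, neg_add_cancel] at h1
      have := neg_abs_le (n - c 0)
      omega⟩
  refine ⟨i, hi, ?_⟩
  by_contra hlt
  have := hmax (i + 1) (not_lt.mp hlt)
  omega

/-- Words are non-empty, so `N` letters on either side of the origin produce at least `N` letters on
either side. The cuts at `-N` agree because both are reached backwards from the same origin across
the same words. -/
theorem eqOn_window (hτ : ∀ b, τ b ≠ []) (h : IsDecomp τ s t c) (h' : IsDecomp τ s' t' c')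
    (hc : c 0 = c' 0) {N : ℕ} (ht : ∀ i : ℤ, -N ≤ i → i < N → t i = t' i) {n : ℤ}
    (h1 : c 0 - N ≤ n) (h2 : n < c 0 + N) : s n = s' n := by
  have e1 : window t (-N) N = window t' (-N) N :=
    window_congr fun j hj1 hj2 => ht j hj1 (by omega)
  have e2 : window t (-N) (N + N) = window t' (-N) (N + N) :=
    window_congr fun j hj1 hj2 => ht j hj1 (by push_cast at hj2; omega)
  have hcN : c (-N) = c' (-N) := by
    have a1 := h.cut_add (-N) N
    have a2 := h'.cut_add (-N) N
    rw [neg_add_cancel] at a1 a2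
    rw [← e1] at a2
    omega
  have b1 := h.window_eq (-N) (N + N)
  have b2 := h'.window_eq (-N) (N + N)
  rw [← e2, ← hcN, ← b1, length_window] at b2
  have d1 := h.add_le_cut hτ (-N) N
  have d2 := h.add_le_cut hτ 0 N
  have d3 := h.cut_add (-N) (N + N)
  push_cast at d3
  rw [neg_add_cancel] at d1
  rw [zero_add] at d2
  rw [neg_add_cancel_left] at d3
  exact (eq_of_window_eq b2 (by omega) (by omega)).symm

theorem unique (hτ : ∀ b, τ b ≠ []) (h : IsDecomp τ s t c) (h' : IsDecomp τ s' t c')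
    (hc : c 0 = c' 0) : s = s' := by
  funext n
  have := abs_le.mp (le_refl |n - c 0|)
  exact eqOn_window hτ h h' hc (N := (n - c 0).natAbs + 1) (fun _ _ _ => rfl)
    (by push_cast; omega) (by push_cast; omega)

end IsDecomp

theorem exists_cut (l : ℤ → ℤ) : ∃ c : ℤ → ℤ, c 0 = 0 ∧ ∀ i, c (i + 1) = c i + l i := by
  -- For each sign of `i` one of the two sums is empty.
  refine ⟨fun i => ∑ j ∈ Finset.Ico 0 i, l j - ∑ j ∈ Finset.Ico i 0, l j, by simp, fun i => ?_⟩
  rcases le_or_gt 0 i with h | h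
  · have e : Finset.Ico 0 (i + 1) = insert i (Finset.Ico 0 i) := by
      ext j
      simp only [Finset.mem_Ico, Finset.mem_insert]
      omega
    dsimp only
    rw [e, Finset.sum_insert (by simp), Finset.Ico_eq_empty_of_le h,
      Finset.Ico_eq_empty_of_le (show (0 : ℤ) ≤ i + 1 by omega)]
    simp [add_comm]
  · have e : Finset.Ico i 0 = insert i (Finset.Ico (i + 1) 0) := by
      ext j
      simp only [Finset.mem_Ico, Finset.mem_insert]
      omega
    dsimp only
    rw [e, Finset.sum_insert (by simp), Finset.Ico_eq_empty_of_le h.le,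
      Finset.Ico_eq_empty_of_le (show i + 1 ≤ 0 by omega)]
    simp

theorem exists_isDecomp {τ : B → List A} (hτ : ∀ b, τ b ≠ []) (t : ℤ → B) :
    ∃ (s : ℤ → A) (c : ℤ → ℤ), c 0 = 0 ∧ IsDecomp τ s t c := by
  obtain ⟨c, hc0, hc⟩ := exists_cut fun i => ((τ (t i)).length : ℤ)
  have hlt : ∀ i, c i < c (i + 1) := fun i => by
    have := List.length_pos_iff.mpr (hτ (t i))
    rw [hc]
    omega
  have hmono : StrictMono c := strictMono_int_of_lt_succ hlt
  -- A default letter for positions outside every block; it spares proving here that there are none.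
  let a₀ : A := (τ (t 0)).head (hτ _)
  have hs : ∀ n : ℤ, ∃ a : A, ∀ i, c i ≤ n → n < c (i + 1) →
      (τ (t i))[(n - c i).toNat]? = some a := by
    intro n
    by_cases hn : ∃ i, c i ≤ n ∧ n < c (i + 1)
    · obtain ⟨i, hi1, hi2⟩ := hn
      have hlen : (n - c i).toNat < (τ (t i)).length := by
        rw [hc] at hi2
        omega
      refine ⟨(τ (t i))[(n - c i).toNat], fun j hj1 hj2 => ?_⟩
      have h1 := hmono.lt_iff_lt.mp (lt_of_le_of_lt hi1 hj2)
      have h2 := hmono.lt_iff_lt.mp (lt_of_le_of_lt hj1 hi2)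
      obtain rfl : i = j := by omega
      exact List.getElem?_eq_getElem hlen
    · exact ⟨a₀, fun i h1 h2 => absurd ⟨i, h1, h2⟩ hn⟩
  choose s hs using hs
  refine ⟨s, c, hc0, fun i => ⟨hc i, ?_⟩⟩
  refine List.ext_getElem (by simp) fun j h1 h2 => ?_
  rw [getElem_window]
  have := hs (c i + j) i (by omega) (by rw [hc]; omega)
  rw [show (c i + j - c i).toNat = j by omega, List.getElem?_eq_getElem h2] at this
  exact (Option.some.inj this).symm

end Window

/-! ### The subshift of a substitution as a topological dynamical system -/

namespace Substitution

open Filter Topology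

variable {A B C : Type u}

namespace Subshift

theorem admitted {φ : Substitution A} (s : φ.Subshift) (i : ℤ) (n : ℕ) :
    φ.Admitted (window s.1 i n) := s.2 i n

theorem isLocallyConstant_apply (φ : Substitution A) (n : ℤ) :
    IsLocallyConstant fun s : φ.Subshift => s.1 n := by
  let _ : TopologicalSpace A := ⊥
  have : DiscreteTopology A := ⟨rfl⟩
  exact (IsLocallyConstant.iff_continuous _).mpr
    ((continuous_apply n).comp (continuous_induced_dom (f := fun s : φ.Subshift => s.1)))

theorem continuous_iff {φ : Substitution A} {Y : Type*} [TopologicalSpace Y]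
    {f : Y → φ.Subshift} :
    Continuous f ↔ ∀ n : ℤ, IsLocallyConstant fun y => (f y).1 n := by
  let _ : TopologicalSpace A := ⊥
  have : DiscreteTopology A := ⟨rfl⟩
  simp only [IsLocallyConstant.iff_continuous]
  exact continuous_induced_rng.trans continuous_pi_iff

theorem eventually_eqOn {φ : Substitution A} (s : φ.Subshift) (N : ℕ) :
    ∀ᶠ t in 𝓝 s, ∀ i : ℤ, -N ≤ i → i < N → t.1 i = s.1 i := by
  have : ∀ᶠ t in 𝓝 s, ∀ i ∈ Finset.Ico (-N : ℤ) N, t.1 i = s.1 i := by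
    rw [Filter.eventually_all_finset]
    intro i _
    exact (IsLocallyConstant.iff_eventually_eq _).mp (isLocallyConstant_apply φ i) s
  filter_upwards [this] with t ht i h1 h2 using ht i (Finset.mem_Ico.mpr ⟨h1, h2⟩)

theorem exists_eqOn_mem {φ : Substitution A} (s : φ.Subshift) {V : Set φ.Subshift}
    (hV : V ∈ 𝓝 s) :
    ∃ N : ℕ, ∀ t : φ.Subshift, (∀ i : ℤ, -N ≤ i → i < N → t.1 i = s.1 i) → t ∈ V := by
  let _ : TopologicalSpace A := ⊥
  have : DiscreteTopology A := ⟨rfl⟩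
  have hV' : V ∈ Filter.comap (fun s : φ.Subshift => s.1) (𝓝 s.1) := by
    rwa [← nhds_induced]
  obtain ⟨W, hW, hWV⟩ := hV'
  rw [nhds_pi, Filter.mem_pi] at hW
  obtain ⟨J, hJ, q, hq, hqW⟩ := hW
  obtain ⟨N, hN⟩ := (hJ.image Int.natAbs).bddAbove
  refine ⟨N + 1, fun t ht => hWV (hqW fun i hi => ?_)⟩
  have : i.natAbs ≤ N := hN ⟨i, hi, rfl⟩
  show t.1 i ∈ q i
  rw [ht i (by push_cast; omega) (by push_cast; omega)]
  exact mem_of_mem_nhds (hq i)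

instance (φ : Substitution A) : T2Space φ.Subshift := by
  let _ : TopologicalSpace A := ⊥
  have : DiscreteTopology A := ⟨rfl⟩
  exact T2Space.of_injective_continuous (f := fun s : φ.Subshift => s.1)
    Subtype.val_injective continuous_induced_dom

instance (φ : Substitution A) : TotallyDisconnectedSpace φ.Subshift := by
  let _ : TopologicalSpace A := ⊥
  have : DiscreteTopology A := ⟨rfl⟩
  refine ⟨fun S _ hS x hx y hy => Subtype.ext ?_⟩
  have h : Continuous fun s : φ.Subshift => s.1 := continuous_induced_dom
  exact isTotallyDisconnected_of_totallyDisconnectedSpace Set.univ _ (Set.subset_univ _)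
    (hS.image _ h.continuousOn) ⟨x, hx, rfl⟩ ⟨y, hy, rfl⟩

theorem isClosed_range [Finite A] (φ : Substitution A) :
    @IsClosed _ (@Pi.topologicalSpace ℤ (fun _ => A) (fun _ => ⊥))
      (Set.range fun s : φ.Subshift => s.1) := by
  let _ : TopologicalSpace A := ⊥
  have : DiscreteTopology A := ⟨rfl⟩
  have e : (Set.range fun s : φ.Subshift => s.1)
      -- Each condition concerns finitely many coordinates, so it is closed in the product topology.
      = ⋂ (i : ℤ) (n : ℕ), {s : ℤ → A | φ.Admitted (window s i n)} := by
    ext s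
    simp only [Set.mem_range, Set.mem_iInter, Set.mem_ofPred_eq]
    exact ⟨fun ⟨t, ht⟩ i n => ht ▸ t.2 i n, fun h => ⟨⟨s, h⟩, rfl⟩⟩
  rw [e]
  refine isClosed_iInter fun i => isClosed_iInter fun n => ?_
  have hc : Continuous fun s : ℤ → A => fun j : Fin n => s (i + (j : ℕ)) := by fun_prop
  exact (isClosed_discrete {v : Fin n → A | φ.Admitted (List.ofFn v)}).preimage hc

instance [Finite A] (φ : Substitution A) : CompactSpace φ.Subshift := by
  let _ : TopologicalSpace A := ⊥
  have : DiscreteTopology A := ⟨rfl⟩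
  have hc : Topology.IsClosedEmbedding fun s : φ.Subshift => s.1 :=
    ⟨⟨⟨rfl⟩, Subtype.val_injective⟩, isClosed_range φ⟩
  exact hc.compactSpace

/-- The shift as a homeomorphism. -/
def shiftHomeo (φ : Substitution A) : φ.Subshift ≃ₜ φ.Subshift where
  toFun := φ.shift
  invFun s := ⟨fun i => s.1 (i + -1), fun i n => by
    have h := s.2 (i + -1) n
    simpa only [add_right_comm] using h⟩
  left_inv s := Subtype.ext (funext fun i => congrArg s.1 (by ring))
  right_inv s := Subtype.ext (funext fun i => congrArg s.1 (by ring))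
  continuous_toFun := continuous_iff.mpr fun n => isLocallyConstant_apply φ (n + 1)
  continuous_invFun := continuous_iff.mpr fun n => isLocallyConstant_apply φ (n + -1)

/-- The shift as a continuous map. -/
abbrev shiftMap (φ : Substitution A) : C(φ.Subshift, φ.Subshift) := (shiftHomeo φ : C(_, _))

theorem shiftMap_apply (φ : Substitution A) (s : φ.Subshift) (i : ℤ) :
    (shiftMap φ s).1 i = s.1 (i + 1) := rfl

theorem iterate_shiftMap_apply (φ : Substitution A) (n : ℕ) (s : φ.Subshift) (i : ℤ) :
    ((shiftMap φ)^[n] s).1 i = s.1 (i + n) := by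
  induction n generalizing i with
  | zero => simp
  | succ n ih =>
    rw [Function.iterate_succ_apply', shiftMap_apply, ih]
    exact congrArg s.1 (by push_cast; ring)

/-- The shifted sequence, by an arbitrary integer. -/
def translate {φ : Substitution A} (s : φ.Subshift) (m : ℤ) : φ.Subshift :=
  ⟨fun i => s.1 (i + m), fun i n => by
    have h := s.2 (i + m) n
    simpa only [add_right_comm] using h⟩

/-- A continuous function on the subshift depends on finitely many coordinates. -/
theorem exists_window [Finite A] {φ : Substitution A} (F : C(φ.Subshift, ℤ)) :
    ∃ N : ℕ, ∀ s t : φ.Subshift, (∀ i : ℤ, -N ≤ i → i < N → s.1 i = t.1 i) → F s = F t := by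
  have key : ∃ N : ℕ, ∀ s ∈ (Set.univ : Set φ.Subshift), ∀ t : φ.Subshift,
      (∀ i : ℤ, -N ≤ i → i < N → s.1 i = t.1 i) → F s = F t := by
    refine isCompact_univ.induction_on (p := fun S : Set φ.Subshift => ∃ N : ℕ, ∀ s ∈ S,
      ∀ t : φ.Subshift, (∀ i : ℤ, -N ≤ i → i < N → s.1 i = t.1 i) → F s = F t) ?_ ?_ ?_ ?_
    · exact ⟨0, by simp⟩
    · rintro S S' h ⟨N, hN⟩
      exact ⟨N, fun s hs => hN s (h hs)⟩
    · rintro S S' ⟨N, hN⟩ ⟨N', hN'⟩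
      refine ⟨max N N', fun s hs t ht => hs.elim (fun hs => hN s hs t fun i h1 h2 => ht i ?_ ?_)
        fun hs => hN' s hs t fun i h1 h2 => ht i ?_ ?_⟩ <;> push_cast <;> omega
    · intro s _
      obtain ⟨N, hN⟩ := exists_eqOn_mem s
        (F.continuous.continuousAt.preimage_mem_nhds ((isOpen_discrete {F s}).mem_nhds rfl))
      refine ⟨_, mem_nhdsWithin_of_mem_nhds (eventually_eqOn s N), N, fun t ht t' htt' => ?_⟩
      rw [show F t = F s from hN t ht, show F t' = F s from
        hN t' fun i h1 h2 => (htt' i h1 h2).symm.trans (ht i h1 h2)]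
  obtain ⟨N, hN⟩ := key
  exact ⟨N, fun s => hN s trivial⟩

/-- A letter that occurs in admitted words arbitrarily far from both ends occurs in the
subshift. -/
theorem exists_apply_zero_eq [Finite A] {φ : Substitution A} (a : A)
    (h : ∀ N : ℕ, ∃ x y : List A, N ≤ x.length ∧ N ≤ y.length ∧ φ.Admitted (x ++ a :: y)) :
    ∃ s : φ.Subshift, s.1 0 = a := by
  let _ : TopologicalSpace A := ⊥
  have : DiscreteTopology A := ⟨rfl⟩
  -- Nested non-empty closed subsets of the compact space `A^ℤ`; a common point has all its windows
  -- inside admitted ones.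
  let K : ℕ → Set (ℤ → A) := fun N => {s | s 0 = a ∧ φ.Admitted (window s (-N) (2 * N + 1))}
  have hclosed : ∀ N, IsClosed (K N) := by
    intro N
    have hc : Continuous fun s : ℤ → A =>
        (s 0, fun j : Fin (2 * N + 1) => s (-N + (j : ℕ))) := by fun_prop
    exact (isClosed_discrete
      {v : A × (Fin (2 * N + 1) → A) | v.1 = a ∧ φ.Admitted (List.ofFn v.2)}).preimage hc
  have hmono : ∀ N, K (N + 1) ⊆ K N := fun N s hs =>
    ⟨hs.1, hs.2.of_infix (window_infix (by push_cast; omega) (by push_cast; omega))⟩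
  have hne : ∀ N, (K N).Nonempty := by
    intro N
    obtain ⟨x, y, hx, hy, hxy⟩ := h N
    let w := x ++ a :: y
    have hw : w.length = x.length + (y.length + 1) := by simp [w]
    -- The word is placed with `a` at position `0`; the letters outside it do not matter.
    refine ⟨fun i => w.getD (i + x.length).toNat a, ?_, ?_⟩
    · simp [w]
    · refine hxy.of_infix ?_
      have : window (fun i : ℤ => w.getD (i + x.length).toNat a) (-x.length) w.length = w := by
        refine List.ext_getElem (by simp) fun j h1 h2 => ?_
        rw [getElem_window]
        simp [h2]
      show _ <:+: w
      nth_rewrite 2 [← this]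
      exact window_infix (by omega) (by push_cast; omega)
  obtain ⟨s, hs⟩ := IsCompact.nonempty_iInter_of_sequence_nonempty_isCompact_isClosed K hmono hne
    (hclosed 0).isCompact hclosed
  have hs' : ∀ N, s ∈ K N := fun N => Set.mem_iInter.mp hs N
  refine ⟨⟨s, fun i n => ?_⟩, (hs' 0).1⟩
  exact (hs' (i.natAbs + n)).2.of_infix (window_infix (by omega) (by omega))

end Subshift

/-- The first Čech cohomology group of the tiling space is the group of coinvariants of the
subshift. -/
noncomputable def cechEquivCoinvariants [Finite A] (φ : Substitution A) :
    CechCohomology 1 φ.TilingSpace ≃ₗ[ℤ] Coinvariants (Subshift.shiftMap φ) :=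
  -- The gluing relation of the tiling space is that of the suspension by definition.
  Suspension.cechEquiv (Subshift.shiftHomeo φ)

/-! ### Word maps -/

/-- A map from letters to non-empty words that preserves admitted words. -/
structure WordMap (θ : Substitution B) (φ : Substitution A) where
  /-- the image of a letter -/
  toFun : B → List A
  ne_nil : ∀ b, toFun b ≠ []
  admitted : ∀ w, θ.Admitted w → φ.Admitted (w.flatMap toFun)

namespace WordMap

variable {θ : Substitution B} {φ : Substitution A} {χ : Substitution C}

@[ext] theorem ext {τ τ' : WordMap θ φ} (h : ∀ b, τ.toFun b = τ'.toFun b) : τ = τ' := by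
  cases τ
  cases τ'
  congr
  exact funext h

/-- Any window is covered by finitely many consecutive blocks, whose concatenation is the image of
an admitted word. -/
theorem mem_subshift (τ : WordMap θ φ) {t : θ.Subshift} {s : ℤ → A} {c : ℤ → ℤ}
    (h : IsDecomp τ.toFun s t.1 c) (i : ℤ) (n : ℕ) : φ.Admitted (window s i n) := by
  have hm := h.strictMono τ.ne_nil
  obtain ⟨p, hp, -⟩ := h.exists_index τ.ne_nil i
  obtain ⟨q, -, hq⟩ := h.exists_index τ.ne_nil (i + n)
  have hpq : p ≤ q := by
    by_contra hlt
    have := hm.monotone (show q + 1 ≤ p by omega)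
    omega
  obtain ⟨m, rfl⟩ := Int.le.dest hpq
  have h1 := τ.admitted _ (t.admitted p (m + 1))
  rw [← h.window_eq] at h1
  refine h1.of_infix (window_infix hp ?_)
  have := h.cut_add p (m + 1)
  push_cast at this
  rw [← add_assoc] at this
  omega

theorem exists_base (τ : WordMap θ φ) (t : θ.Subshift) :
    ∃ (s : φ.Subshift) (c : ℤ → ℤ), c 0 = 0 ∧ IsDecomp τ.toFun s.1 t.1 c := by
  obtain ⟨s, c, hc, h⟩ := exists_isDecomp τ.ne_nil t.1
  exact ⟨⟨s, τ.mem_subshift h⟩, c, hc, h⟩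

/-- The map of subshifts that replaces letters by words. -/
noncomputable def base (τ : WordMap θ φ) (t : θ.Subshift) : φ.Subshift := (τ.exists_base t).choose

/-- The positions of the words in `base`. -/
noncomputable def cut (τ : WordMap θ φ) (t : θ.Subshift) : ℤ → ℤ :=
  (τ.exists_base t).choose_spec.choose

theorem cut_zero (τ : WordMap θ φ) (t : θ.Subshift) : τ.cut t 0 = 0 :=
  (τ.exists_base t).choose_spec.choose_spec.1

theorem isDecomp (τ : WordMap θ φ) (t : θ.Subshift) :
    IsDecomp τ.toFun (τ.base t).1 t.1 (τ.cut t) :=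
  (τ.exists_base t).choose_spec.choose_spec.2

theorem base_eq (τ : WordMap θ φ) {t : θ.Subshift} {s : φ.Subshift} {c : ℤ → ℤ} (hc : c 0 = 0)
    (h : IsDecomp τ.toFun s.1 t.1 c) : τ.base t = s :=
  Subtype.ext ((τ.isDecomp t).unique τ.ne_nil h ((τ.cut_zero t).trans hc.symm))

theorem cut_one (τ : WordMap θ φ) (t : θ.Subshift) :
    τ.cut t 1 = (τ.toFun (t.1 0)).length := by
  have := (τ.isDecomp t 0).1
  rwa [zero_add, cut_zero, zero_add] at this

theorem continuous_base (τ : WordMap θ φ) : Continuous τ.base := by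
  refine Subshift.continuous_iff.mpr fun n =>
    (IsLocallyConstant.iff_eventually_eq _).mpr fun t => ?_
  filter_upwards [Subshift.eventually_eqOn t (n.natAbs + 1)] with t' ht'
  refine (τ.isDecomp t').eqOn_window τ.ne_nil (τ.isDecomp t) ?_ ht' ?_ ?_ <;>
    simp only [cut_zero] <;> omega

theorem base_shift (τ : WordMap θ φ) (t : θ.Subshift) :
    (Subshift.shiftMap φ)^[(τ.toFun (t.1 0)).length] (τ.base t)
      = τ.base (Subshift.shiftMap θ t) := by
  refine (τ.base_eq (c := fun i => τ.cut t (i + 1) - τ.cut t 1) (by simp) ?_).symm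
  have h := ((τ.isDecomp t).reindex 1).shift (τ.cut t 1)
  convert h using 2 with i
  · rw [Subshift.iterate_shiftMap_apply, cut_one]
  · rfl

/-- The tower map of a word map. -/
noncomputable def tower (τ : WordMap θ φ) :
    TowerMap (Subshift.shiftMap θ) (Subshift.shiftMap φ) where
  base := ⟨τ.base, τ.continuous_base⟩
  height := ⟨fun t => (τ.toFun (t.1 0)).length,
    ((Subshift.isLocallyConstant_apply θ 0).comp fun b => (τ.toFun b).length).continuous⟩
  iterate_height t := τ.base_shift t

theorem tower_base (τ : WordMap θ φ) (t : θ.Subshift) : τ.tower.base t = τ.base t := rfl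

theorem tower_height (τ : WordMap θ φ) (t : θ.Subshift) :
    τ.tower.height t = (τ.toFun (t.1 0)).length := rfl

/-- Composition of word maps. -/
def comp (τ : WordMap θ φ) (ρ : WordMap χ θ) : WordMap χ φ where
  toFun x := (ρ.toFun x).flatMap τ.toFun
  ne_nil x h := by
    have h1 := IsDecomp.length_flatMap_ge τ.ne_nil (ρ.toFun x)
    rw [h] at h1
    exact ρ.ne_nil x (List.length_eq_zero_iff.mp (Nat.le_zero.mp h1))
  admitted w hw := by
    have := τ.admitted _ (ρ.admitted w hw)
    rwa [List.flatMap_assoc] at this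

theorem comp_base (τ : WordMap θ φ) (ρ : WordMap χ θ) (u : χ.Subshift) :
    (τ.comp ρ).base u = τ.base (ρ.base u) :=
  base_eq _ (c := fun i => τ.cut (ρ.base u) (ρ.cut u i)) (by simp only [cut_zero])
    ((τ.isDecomp _).comp (ρ.isDecomp u))

theorem birkhoffSum_height (τ : WordMap θ φ) (n : ℕ) (t : θ.Subshift) :
    birkhoffSum (Subshift.shiftMap θ) τ.tower.height n t
      = ((window t.1 0 n).flatMap τ.toFun).length := by
  induction n with
  | zero => simp
  | succ n ih =>
    rw [birkhoffSum_succ, ih, window_succ', tower_height, Subshift.iterate_shiftMap_apply]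
    simp

theorem comp_height (τ : WordMap θ φ) (ρ : WordMap χ θ) (u : χ.Subshift) :
    (τ.comp ρ).tower.height u = (τ.tower.comp ρ.tower).height u := by
  rw [TowerMap.comp_height, birkhoffSum_height, tower_height, tower_height]
  have := (ρ.isDecomp u 0).2
  rw [cut_zero] at this
  show ((ρ.toFun (u.1 0)).flatMap τ.toFun).length = _
  rw [tower_base, this]

theorem comp_transfer (τ : WordMap θ φ) (ρ : WordMap χ θ) (F : C(φ.Subshift, ℤ)) :
    (τ.comp ρ).tower.transfer F = ρ.tower.transfer (τ.tower.transfer F) := by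
  rw [← TowerMap.transfer_comp]
  ext u
  rw [TowerMap.transfer_apply, TowerMap.transfer_apply, comp_height, tower_base, comp_base]
  rfl

theorem comp_coinvTransfer (τ : WordMap θ φ) (ρ : WordMap χ θ)
    (x : Coinvariants (Subshift.shiftMap φ)) :
    (τ.comp ρ).tower.coinvTransfer x = ρ.tower.coinvTransfer (τ.tower.coinvTransfer x) := by
  obtain ⟨F, rfl⟩ := Submodule.Quotient.mk_surjective _ x
  simp only [TowerMap.coinvTransfer_mk, comp_transfer]

/-- Every point of the target has exactly one decomposition, up to renumbering. -/
def IsRecognisable (τ : WordMap θ φ) : Prop :=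
  ∀ s : φ.Subshift, ∃! p : θ.Subshift × (ℤ → ℤ),
    IsDecomp τ.toFun s.1 p.1.1 p.2 ∧ p.2 0 ≤ 0 ∧ 0 < p.2 1

/-- A decomposition of `s` whose block number `0` covers position `0` is the same as a tower and a
level: the level is the offset `-c 0` of position `0` inside its block. -/
theorem IsRecognisable.isPartition {τ : WordMap θ φ} (hτ : τ.IsRecognisable) :
    τ.tower.IsPartition := by
  intro s
  obtain ⟨⟨t, c⟩, ⟨h, h0, h1⟩, huniq⟩ := hτ s
  dsimp only at h h0 h1
  have hc := (h 0).1
  rw [zero_add] at hc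
  refine ⟨(t, (-c 0).toNat), ⟨?_, ?_⟩, ?_⟩
  · have h2 : (-c 0).toNat < (τ.toFun (t.1 0)).length := by omega
    exact h2
  · have hb : τ.base t = s.translate (c 0) :=
      τ.base_eq (c := fun i => c i - c 0) (by simp) (h.shift (c 0))
    apply Subtype.ext
    funext i
    rw [Subshift.iterate_shiftMap_apply, tower_base, hb]
    show s.1 (i + ((-c 0).toNat : ℤ) + c 0) = s.1 i
    exact congrArg s.1 (by omega)
  · rintro ⟨t', n⟩ ⟨hn, hs⟩
    rw [tower_height] at hn
    dsimp only at hn hs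
    have hs' : s.1 = fun i => (τ.base t').1 (i + n) := by
      funext i
      rw [← hs, Subshift.iterate_shiftMap_apply, tower_base]
    have h' := (τ.isDecomp t').shift n
    rw [← hs'] at h'
    have e := huniq (t', fun i => τ.cut t' i - n)
      ⟨h', by simp only [cut_zero]; omega, by simp only [cut_one]; omega⟩
    simp only [Prod.mk.injEq] at e
    obtain ⟨rfl, rfl⟩ := e
    simp [cut_zero]

theorem IsRecognisable.coinvTransfer_bijective [Finite B] {τ : WordMap θ φ}
    (hτ : τ.IsRecognisable) : Function.Bijective τ.tower.coinvTransfer :=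
  hτ.isPartition.coinvTransfer_bijective fun t => List.length_pos_iff.mpr (τ.ne_nil (t.1 0))

end WordMap

end Substitution

namespace Substitution

variable {A : Type u}

/-! ### Iterates, primitivity and bounded gaps -/

theorem iter_zero (φ : Substitution A) (w : List A) : φ.iter 0 w = w := rfl

theorem iter_succ (φ : Substitution A) (n : ℕ) (w : List A) :
    φ.iter (n + 1) w = φ.iter n (φ.onWord w) := rfl

theorem iter_add (φ : Substitution A) (m n : ℕ) (w : List A) :
    φ.iter (m + n) w = φ.iter m (φ.iter n w) := by
  simp only [iter, Function.iterate_add_apply]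

theorem iter_nil (φ : Substitution A) (n : ℕ) : φ.iter n [] = [] := by
  induction n with
  | zero => rfl
  | succ n ih => exact ih

theorem iter_eq_flatMap (φ : Substitution A) (n : ℕ) (w : List A) :
    φ.iter n w = w.flatMap fun c => φ.iter n [c] := by
  induction w with
  | nil => simp [iter_nil]
  | cons c w ih =>
    rw [List.flatMap_cons, ← ih, ← iter_append]
    rfl

theorem iter_infix (φ : Substitution A) (n : ℕ) {v w : List A} (h : v <:+: w) :
    φ.iter n v <:+: φ.iter n w := by
  obtain ⟨x, y, rfl⟩ := h
  exact ⟨φ.iter n x, φ.iter n y, by rw [iter_append, iter_append]⟩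

theorem singleton_infix_of_mem {a : A} {w : List A} (h : a ∈ w) : [a] <:+: w := by
  obtain ⟨x, y, rfl⟩ := List.append_of_mem h
  exact ⟨x, y, by simp⟩

section Count

variable [Fintype A] [DecidableEq A]

theorem count_iter (φ : Substitution A) (n : ℕ) (i : A) (w : List A) :
    (φ.iter n w).count i = ∑ l, (φ.iter n [l]).count i * w.count l := by
  induction w with
  | nil => simp [iter_nil]
  | cons c w ih =>
    have : φ.iter n (c :: w) = φ.iter n [c] ++ φ.iter n w := by
      rw [← iter_append]
      rfl
    rw [this, List.count_append, ih]
    simp only [List.count_cons, beq_iff_eq, mul_add, Finset.sum_add_distrib, mul_ite, mul_one,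
      mul_zero, Finset.sum_ite_eq, Finset.mem_univ, if_true]
    ring

end Count

open Classical in
theorem matrix_pow_apply [Fintype A] (φ : Substitution A) (n : ℕ) (i j : A) :
    (φ.matrix ^ n) i j = ((φ.iter n [j]).count i : ℤ) := by
  induction n generalizing j with
  | zero =>
    rw [pow_zero, iter_zero, Matrix.one_apply]
    by_cases hij : i = j
    · simp [hij]
    · simp [hij, Ne.symm hij]
  | succ n ih =>
    rw [pow_succ, Matrix.mul_apply, iter_succ, count_iter]
    push_cast
    refine Finset.sum_congr rfl fun l _ => ?_
    rw [ih]
    simp [onWord, matrix]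

theorem IsPrimitive.exists_mem_iter [Fintype A] {φ : Substitution A} (hφ : φ.IsPrimitive) :
    ∃ p : ℕ, ∀ n, p ≤ n → ∀ b c : A, b ∈ φ.iter n [c] := by
  classical
  obtain ⟨p, -, hp⟩ := hφ
  have h0 : ∀ b c : A, b ∈ φ.iter p [c] := by
    intro b c
    have := hp b c
    rw [matrix_pow_apply] at this
    exact List.count_pos_iff.mp (by exact_mod_cast this)
  refine ⟨p, fun n hn b c => ?_⟩
  obtain ⟨m, rfl⟩ := Nat.exists_eq_add_of_le hn
  obtain ⟨d, hd⟩ := List.exists_mem_of_ne_nil _ (φ.iter_ne_nil m (w := [c]) (by simp))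
  rw [iter_add]
  exact (φ.iter_infix p (singleton_infix_of_mem hd)).subset (h0 b d)

/-- Every admitted word occurs in all high iterates of all letters. -/
theorem IsPrimitive.exists_infix_iter [Fintype A] {φ : Substitution A} (hφ : φ.IsPrimitive)
    {w : List A} (hw : φ.Admitted w) : ∃ N₀, ∀ N, N₀ ≤ N → ∀ c, w <:+: φ.iter N [c] := by
  obtain ⟨p, hp⟩ := hφ.exists_mem_iter
  rcases hw with rfl | ⟨b, n, hw⟩
  · exact ⟨0, fun N _ c => List.nil_infix⟩
  · refine ⟨n + p, fun N hN c => ?_⟩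
    obtain ⟨m, rfl⟩ : ∃ m, N = n + m := ⟨N - n, by omega⟩
    rw [iter_add]
    exact hw.trans (φ.iter_infix n (singleton_infix_of_mem (hp m (by omega) b c)))

/-- A word that starts at a block boundary and avoids `a` cannot contain the whole first block. -/
theorem length_le_of_prefix_flatMap {B : Type*} {f : B → List A} {a : A} {K : ℕ}
    (ha : ∀ c, a ∈ f c) (hK : ∀ c, (f c).length ≤ K) {z : List B} {w q : List A}
    (h : w ++ q = z.flatMap f) (hw : a ∉ w) : w.length ≤ K := by
  cases z with
  | nil =>
    have := List.append_eq_nil_iff.mp h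
    simp [this.1]
  | cons c z =>
    rw [List.flatMap_cons, List.append_eq_append_iff] at h
    rcases h with ⟨x, hx, -⟩ | ⟨x, hx, -⟩
    · refine le_trans ?_ (hK c)
      simp [hx]
    · exact absurd (by rw [hx]; exact List.mem_append_left _ (ha c)) hw

/-- A word avoiding `a` contains no complete block, so it meets at most the end of one block and the
beginning of the next. -/
theorem length_le_of_infix_flatMap {B : Type*} {f : B → List A} {a : A} {K : ℕ}
    (ha : ∀ c, a ∈ f c) (hK : ∀ c, (f c).length ≤ K) {z : List B} {p w q : List A}
    (h : p ++ (w ++ q) = z.flatMap f) (hw : a ∉ w) : w.length ≤ K + K := by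
  induction z generalizing p with
  | nil =>
    have h1 := (List.append_eq_nil_iff.mp h).2
    have h2 := List.append_eq_nil_iff.mp h1
    simp [h2.1]
  | cons c z ih =>
    rw [List.flatMap_cons, List.append_eq_append_iff] at h
    rcases h with ⟨x, hx, h⟩ | ⟨x, -, h⟩
    · rw [List.append_eq_append_iff] at h
      have hxK : x.length ≤ K := by
        refine le_trans ?_ (hK c)
        simp [hx]
      rcases h with ⟨y, hy, -⟩ | ⟨y, hy, h⟩
      · have : w.length ≤ x.length := by simp [hy]
        omega
      · have := length_le_of_prefix_flatMap ha hK h.symm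
          (fun hay => hw (by rw [hy]; exact List.mem_append_right _ hay))
        rw [hy, List.length_append]
        omega
    · exact ih h.symm

/-- The gaps between the occurrences of a letter are bounded. -/
theorem IsPrimitive.exists_gap [Fintype A] {φ : Substitution A} (hφ : φ.IsPrimitive) (a : A) :
    ∃ L, ∀ w, φ.Admitted w → a ∉ w → w.length ≤ L := by
  obtain ⟨p, hp⟩ := hφ.exists_mem_iter
  obtain ⟨K, hK⟩ := (Set.finite_range fun c => (φ.iter p [c]).length).bddAbove
  refine ⟨K + K, fun w hw haw => ?_⟩
  obtain ⟨N₀, hN⟩ := hφ.exists_infix_iter hw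
  obtain ⟨x, y, hxy⟩ := hN (p + N₀) (by omega) a
  rw [iter_add, iter_eq_flatMap, List.append_assoc] at hxy
  exact length_le_of_infix_flatMap (hp p le_rfl a) (fun c => hK ⟨c, rfl⟩) hxy haw

/-! ### Return words -/

section ReturnWord

variable {φ : Substitution A} {a : A} {k : ℕ}

theorem IsPrimitive.finite_returnWord [Fintype A] (hφ : φ.IsPrimitive) (a : A) :
    Finite (φ.ReturnWord a) := by
  obtain ⟨L, hL⟩ := hφ.exists_gap a
  have : {w : List A | w.length ≤ L + 1}.Finite := List.finite_length_le A (L + 1)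
  refine (this.subset ?_ : {v | φ.IsReturnWord a v}.Finite).to_subtype
  rintro v ⟨⟨u, rfl, hu⟩, hv⟩
  have := hL u (hv.of_infix ⟨[a], [a], by simp⟩) hu
  simpa using this

theorem concat_eq_flatMap (x : List (φ.ReturnWord a)) :
    φ.concat a x = x.flatMap fun v => v.1 := rfl

theorem concat_append (x y : List (φ.ReturnWord a)) :
    φ.concat a (x ++ y) = φ.concat a x ++ φ.concat a y := by
  simp [concat_eq_flatMap]

theorem ReturnWord.exists_eq (v : φ.ReturnWord a) : ∃ u, v.1 = a :: u ∧ a ∉ u := v.2.1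

theorem ReturnWord.ne_nil (v : φ.ReturnWord a) : v.1 ≠ [] := by
  obtain ⟨u, hu, -⟩ := v.exists_eq
  simp [hu]

theorem append_cons_inj {u u' r r' : List A} (hu : a ∉ u) (hu' : a ∉ u')
    (h : u ++ a :: r = u' ++ a :: r') : u = u' ∧ r = r' := by
  rw [List.append_eq_append_iff] at h
  rcases h with ⟨x, hx, h⟩ | ⟨x, hx, h⟩
  · cases x with
    | nil => simp_all
    | cons b x =>
      simp only [List.cons_append, List.cons.injEq] at h
      exact absurd (by rw [hx, ← h.1]; simp) hu'
  · cases x with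
    | nil => simp_all
    | cons b x =>
      simp only [List.cons_append, List.cons.injEq] at h
      exact absurd (by rw [hx, ← h.1]; simp) hu

theorem concat_append_singleton (x : List (φ.ReturnWord a)) :
    ∃ r, φ.concat a x ++ [a] = a :: r := by
  cases x with
  | nil => exact ⟨[], rfl⟩
  | cons v x =>
    obtain ⟨u, hu, -⟩ := v.exists_eq
    exact ⟨_, by rw [concat_cons, hu]; rfl⟩

/-- The extra letter `a` marks where the last return word of `x` stops; without it that word could
be a proper prefix of a longer return word in `y`. -/
theorem prefix_of_concat_prefix {x y : List (φ.ReturnWord a)} {q : List A}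
    (h : φ.concat a x ++ [a] ++ q = φ.concat a y) : x <+: y := by
  induction x generalizing y with
  | nil => exact List.nil_prefix
  | cons v x ih =>
    cases y with
    | nil =>
      rw [concat_nil] at h
      simp at h
    | cons w y =>
      obtain ⟨u, hu, hau⟩ := v.exists_eq
      obtain ⟨u', hu', hau'⟩ := w.exists_eq
      rw [concat_cons, concat_cons, hu, hu', List.append_assoc, List.append_assoc,
        ← List.append_assoc (φ.concat a x)] at h
      obtain ⟨r, hr⟩ := concat_append_singleton x
      simp only [List.cons_append, List.cons.injEq, true_and] at h
      cases y with
      | nil =>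
        rw [concat_nil, List.append_nil, hr] at h
        exact absurd (by rw [← h]; simp) hau'
      | cons w' y =>
        obtain ⟨u'', hu'', -⟩ := w'.exists_eq
        have hy : φ.concat a (w' :: y) = a :: (u'' ++ φ.concat a y) := by
          rw [concat_cons, hu'']
          rfl
        have h' := h
        rw [hr, hy, List.cons_append] at h'
        obtain ⟨e, -⟩ := append_cons_inj hau hau' h'
        obtain rfl : v = w := Subtype.ext (by rw [hu, hu', e])
        rw [e] at h
        obtain ⟨z, hz⟩ := ih (List.append_cancel_left h)
        exact ⟨z, by rw [← hz]; rfl⟩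

/-- The decomposition into return words is determined by the occurrences of `a`. -/
theorem infix_of_concat_infix {x y : List (φ.ReturnWord a)}
    (h : φ.concat a x ++ [a] <:+: φ.concat a y) : x <:+: y := by
  obtain ⟨p, q, h⟩ := h
  rw [List.append_assoc] at h
  induction y generalizing p with
  | nil =>
    rw [concat_nil] at h
    simp at h
  | cons w y ih =>
    cases p with
    | nil => exact (prefix_of_concat_prefix h).isInfix
    | cons b p =>
      obtain ⟨u, hu, hau⟩ := w.exists_eq
      obtain ⟨r, hr⟩ := concat_append_singleton x
      have h0 := h
      rw [concat_cons, List.append_eq_append_iff] at h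
      -- The occurrence begins with `a`, so it cannot start strictly inside the return word `w`: it
      -- starts at the next cut or later.
      rcases h with ⟨z, hz, h⟩ | ⟨z, hz, h⟩
      · cases z with
        | nil =>
          rw [List.nil_append] at h
          exact (ih [] h).trans (List.suffix_cons w y).isInfix
        | cons d z =>
          rw [hr] at h
          simp only [List.cons_append, List.cons.injEq] at h
          rw [hu] at hz
          simp only [List.cons_append, List.cons.injEq] at hz
          exact absurd (by rw [hz.2, ← h.1]; simp) hau
      · exact (ih z h.symm).trans (List.suffix_cons w y).isInfix

theorem concat_preLeftProperisation (h : φ.IsFixedLetter a k) (v : φ.ReturnWord a) :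
    φ.concat a ((φ.preLeftProperisation a k h).toFun v) = φ.iter k v.1 :=
  (φ.exists_decomposition h v).choose_spec

theorem concat_onWord (h : φ.IsFixedLetter a k) (x : List (φ.ReturnWord a)) :
    φ.concat a ((φ.preLeftProperisation a k h).onWord x) = φ.iter k (φ.concat a x) := by
  induction x with
  | nil => rw [concat_nil, iter_nil]; rfl
  | cons v x ih =>
    rw [concat_cons, iter_append, ← ih, ← concat_preLeftProperisation h, ← concat_append]
    rfl

theorem concat_iter (h : φ.IsFixedLetter a k) (n : ℕ) (x : List (φ.ReturnWord a)) :
    φ.concat a ((φ.preLeftProperisation a k h).iter n x) = φ.iter (k * n) (φ.concat a x) := by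
  induction n generalizing x with
  | zero => rfl
  | succ n ih => rw [iter_succ, ih, concat_onWord, mul_add, mul_one, iter_add]

theorem concat_admitted (h : φ.IsFixedLetter a k) {x : List (φ.ReturnWord a)}
    (hx : (φ.preLeftProperisation a k h).Admitted x) : φ.Admitted (φ.concat a x) := by
  rcases hx with rfl | ⟨v, n, p, q, hx⟩
  · exact Or.inl rfl
  · have h1 : φ.Admitted (φ.iter (k * n) v.1) :=
      Admitted.iter (v.2.2.of_infix (List.prefix_append _ _).isInfix) _
    have h2 := concat_iter h n [v]
    rw [concat_cons, concat_nil, List.append_nil] at h2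
    rw [← h2, ← hx, concat_append, concat_append] at h1
    exact h1.of_infix ⟨_, _, rfl⟩

/-- The word occurs in `φ^(kN)(a)`, a prefix of `φ^(kN)(v)`, which is the concatenation of `ψ^N(v)`.
The occurrences of `a` then lift the inclusion to return words. -/
theorem IsPrimitive.exists_infix_iter_returnWord [Fintype A] (hφ : φ.IsPrimitive)
    (h : φ.IsFixedLetter a k) {x : List (φ.ReturnWord a)}
    (hx : φ.Admitted (φ.concat a x ++ [a])) :
    ∃ N₀, ∀ N, N₀ ≤ N → ∀ v, x <:+: (φ.preLeftProperisation a k h).iter N [v] := by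
  obtain ⟨N₀, hN⟩ := hφ.exists_infix_iter hx
  refine ⟨N₀, fun N hNN v => infix_of_concat_infix ?_⟩
  rw [concat_iter, concat_cons, concat_nil, List.append_nil]
  obtain ⟨u, hu, -⟩ := v.exists_eq
  refine (hN (k * N) (hNN.trans (Nat.le_mul_of_pos_left N h.1)) a).trans (φ.iter_infix _ ?_)
  rw [hu]
  exact ⟨[], u, rfl⟩

theorem IsFixedLetter.iter_mul (h : φ.IsFixedLetter a k) (n : ℕ) :
    ∃ r, φ.iter (k * n) [a] = a :: r := by
  induction n with
  | zero => exact ⟨[], rfl⟩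
  | succ n ih =>
    obtain ⟨-, u, hu⟩ := h
    obtain ⟨r, hr⟩ := ih
    refine ⟨r ++ φ.iter (k * n) u, ?_⟩
    rw [mul_add, mul_one, iter_add, hu, ← List.singleton_append, iter_append, hr]
    rfl

/-- Some power of the pre-left properisation is left proper. -/
theorem IsPrimitive.isPreLeftProper [Fintype A] (hφ : φ.IsPrimitive) (h : φ.IsFixedLetter a k)
    [hne : Nonempty (φ.ReturnWord a)] : (φ.preLeftProperisation a k h).IsPreLeftProper := by
  obtain ⟨v⟩ := hne
  obtain ⟨N₀, hN⟩ := hφ.exists_infix_iter v.2.2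
  obtain ⟨r, hr⟩ := h.iter_mul (N₀ + 1)
  -- The word `v a` contains `a` twice and occurs in `a r`, so `r` contains `a`.
  have har : a ∈ r := by
    obtain ⟨p, q, hpq⟩ := hN (k * (N₀ + 1))
      ((Nat.le_succ _).trans (Nat.le_mul_of_pos_left _ h.1)) a
    obtain ⟨u, hu, -⟩ := v.exists_eq
    rw [hr, hu] at hpq
    cases p with
    | nil =>
      simp only [List.nil_append, List.cons_append, List.cons.injEq, true_and] at hpq
      rw [← hpq]
      simp
    | cons b p =>
      simp only [List.cons_append, List.cons.injEq] at hpq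
      rw [← hpq.2]
      simp
  obtain ⟨u, r', hr', hau⟩ := List.eq_append_cons_of_mem har
  have hadm : φ.Admitted ((a :: u) ++ [a]) := by
    refine Or.inr ⟨a, k * (N₀ + 1), ?_⟩
    rw [hr, hr']
    exact ⟨[], r', by simp⟩
  obtain ⟨v₀, hv₀⟩ := φ.exists_returnWord hau hadm
  refine ⟨N₀ + 1, Nat.succ_pos _, v₀, fun w => ?_⟩
  obtain ⟨uw, huw, -⟩ := w.exists_eq
  have e : φ.concat a ((φ.preLeftProperisation a k h).iter (N₀ + 1) [w])
      = (a :: u) ++ a :: (r' ++ φ.iter (k * (N₀ + 1)) uw) := by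
    rw [concat_iter, concat_cons, concat_nil, List.append_nil, huw, ← List.singleton_append,
      iter_append, hr, hr']
    simp
  obtain ⟨z, hz⟩ := prefix_of_concat_prefix (x := [v₀])
    (y := (φ.preLeftProperisation a k h).iter (N₀ + 1) [w])
    (q := r' ++ φ.iter (k * (N₀ + 1)) uw) (by
      rw [e, concat_cons, concat_nil, List.append_nil, hv₀]
      simp)
  refine ⟨z, ?_, hz.symm⟩
  -- The concatenation continues with a second `a` after `a u`, so more than one return word is
  -- present.
  rintro rfl
  rw [← hz, List.append_nil, concat_cons, concat_nil, List.append_nil, hv₀] at e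
  simp at e

end ReturnWord

end Substitution

namespace Substitution

variable {A : Type u}

/-! ### The word maps of a substitution and of its return words -/

/-- A substitution as a word map. -/
def selfMap (φ : Substitution A) : WordMap φ φ where
  toFun := φ.toFun
  ne_nil := φ.ne_nil
  admitted _ hw := hw.iter 1

/-- The powers of a substitution as word maps. -/
def powMap (φ : Substitution A) (n : ℕ) : WordMap φ φ where
  toFun c := φ.iter n [c]
  ne_nil := (φ.pow n).ne_nil
  admitted w hw := by
    rw [← iter_eq_flatMap]
    exact hw.iter n

theorem powMap_add (φ : Substitution A) (m n : ℕ) :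
    φ.powMap (m + n) = (φ.powMap m).comp (φ.powMap n) :=
  WordMap.ext fun c => (φ.iter_add m n [c]).trans (φ.iter_eq_flatMap m _)

theorem powMap_one (φ : Substitution A) : φ.powMap 1 = φ.selfMap :=
  WordMap.ext fun c => List.append_nil (φ.toFun c)

theorem transfer_powMap_zero (φ : Substitution A) (F : C(φ.Subshift, ℤ)) :
    (φ.powMap 0).tower.transfer F = F := by
  ext t
  rw [TowerMap.transfer_apply]
  have : (φ.powMap 0).base t = t :=
    WordMap.base_eq _ (c := id) rfl fun i => ⟨rfl, window_one t.1 i⟩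
  rw [WordMap.tower_base, this]
  exact birkhoffSum_one _ _ _

theorem coinvTransfer_powMap (φ : Substitution A) (n : ℕ) (x : Coinvariants (Subshift.shiftMap φ)) :
    (φ.powMap n).tower.coinvTransfer x = (φ.selfMap.tower.coinvTransfer)^[n] x := by
  induction n with
  | zero =>
    obtain ⟨F, rfl⟩ := Submodule.Quotient.mk_surjective _ x
    rw [TowerMap.coinvTransfer_mk, transfer_powMap_zero]
    rfl
  | succ n ih =>
    rw [powMap_add, powMap_one, WordMap.comp_coinvTransfer, ih, Function.iterate_succ_apply']

theorem IsRecognisable.coinvTransfer_powMap_bijective [Finite A] {φ : Substitution A}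
    (hφ : φ.IsRecognisable) (n : ℕ) :
    Function.Bijective (φ.powMap n).tower.coinvTransfer := by
  have h : φ.selfMap.IsRecognisable := hφ
  rw [funext (φ.coinvTransfer_powMap n)]
  exact h.coinvTransfer_bijective.iterate n

section ReturnWord

variable {φ : Substitution A} {a : A} {k : ℕ}

/-- The concatenation of return words as a word map. -/
def concatMap (h : φ.IsFixedLetter a k) : WordMap (φ.preLeftProperisation a k h) φ where
  toFun v := v.1
  ne_nil v := v.ne_nil
  admitted _ hw := concat_admitted h hw

/-- The intertwining square that transports bijectivity of the transfer from `φᵏ` to `ψ`. -/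
theorem concatMap_comp_selfMap (h : φ.IsFixedLetter a k) :
    (concatMap h).comp (φ.preLeftProperisation a k h).selfMap
      = (φ.powMap k).comp (concatMap h) :=
  WordMap.ext fun v => (concat_preLeftProperisation h v).trans (φ.iter_eq_flatMap k v.1)

/-- A set of integers unbounded in both directions is order isomorphic to `ℤ`; the numbering is
shifted so that index `0` is its last element that is at most `0`. -/
theorem exists_strictMono_range_eq {Q : ℤ → Prop} (habove : ∀ n, ∃ m, n < m ∧ Q m)
    (hbelow : ∀ n, ∃ m, m < n ∧ Q m) :
    ∃ c : ℤ → ℤ, StrictMono c ∧ (∀ n, Q n ↔ ∃ i, c i = n) ∧ c 0 ≤ 0 ∧ 0 < c 1 := by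
  classical
  have : NoMaxOrder {n // Q n} := ⟨fun n =>
    let ⟨m, h, hm⟩ := habove n.1
    ⟨⟨m, hm⟩, h⟩⟩
  have : NoMinOrder {n // Q n} := ⟨fun n =>
    let ⟨m, h, hm⟩ := hbelow n.1
    ⟨⟨m, hm⟩, h⟩⟩
  have : Nonempty {n // Q n} :=
    let ⟨m, _, hm⟩ := habove 0
    ⟨⟨m, hm⟩⟩
  let _ := LinearLocallyFiniteOrder.succOrder {n // Q n}
  let _ := LinearLocallyFiniteOrder.predOrder {n // Q n}
  let e : {n // Q n} ≃o ℤ := orderIsoIntOfLinearSuccPredArch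
  have hmono : StrictMono fun i => (e.symm i).1 := fun i j hij => e.symm.strictMono hij
  obtain ⟨i, hi, hmax⟩ := Int.exists_greatest_of_bdd (P := fun i => (e.symm i).1 ≤ 0)
    (by
      obtain ⟨m, h, hm⟩ := habove 0
      refine ⟨e ⟨m, hm⟩, fun z hz => ?_⟩
      by_contra hlt
      have := hmono (not_le.mp hlt)
      simp only [OrderIso.symm_apply_apply] at this
      omega)
    (by
      obtain ⟨m, h, hm⟩ := hbelow 0
      exact ⟨e ⟨m, hm⟩, by simpa using h.le⟩)
  refine ⟨fun j => (e.symm (j + i)).1, fun j l hjl => hmono (by simpa using hjl), fun n =>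
    ⟨fun hn => ⟨e ⟨n, hn⟩ - i, by simp⟩, ?_⟩, by simpa using hi, ?_⟩
  · rintro ⟨j, rfl⟩
    exact (e.symm (j + i)).2
  · by_contra hlt
    have := hmax (1 + i) (not_lt.mp hlt)
    omega

/-- The position of `0` fixes the value at index `0`; from there the neighbours agree, being the
next elements of the same set. -/
theorem eq_of_strictMono_of_range_eq {c c' : ℤ → ℤ} (hc : StrictMono c) (hc' : StrictMono c')
    (h : ∀ i, ∃ j, c' j = c i) (h' : ∀ i, ∃ j, c j = c' i) (h0 : c 0 ≤ 0) (h1 : 0 < c 1)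
    (h0' : c' 0 ≤ 0) (h1' : 0 < c' 1) : c = c' := by
  have key : ∀ {c c' : ℤ → ℤ}, StrictMono c → StrictMono c' → (∀ i, ∃ j, c' j = c i) →
      ∀ i, (c i = c' i → c' (i + 1) ≤ c (i + 1) ∧ c (i - 1) ≤ c' (i - 1)) := by
    intro c c' hc hc' h i hi
    obtain ⟨j, hj⟩ := h (i + 1)
    obtain ⟨l, hl⟩ := h (i - 1)
    have a1 : c' i < c' j := by rw [hj, ← hi]; exact hc (by omega)
    have a2 : c' l < c' i := by rw [hl, ← hi]; exact hc (by omega)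
    rw [hc'.lt_iff_lt] at a1 a2
    rw [← hj, ← hl, hc'.le_iff_le, hc'.le_iff_le]
    omega
  have key0 : ∀ {c c' : ℤ → ℤ}, StrictMono c' → (∀ i, ∃ j, c' j = c i) → c 0 ≤ 0 → 0 < c' 1 →
      c 0 ≤ c' 0 := by
    intro c c' hc' h h0 h1'
    obtain ⟨j, hj⟩ := h 0
    have : c' j < c' 1 := by omega
    rw [hc'.lt_iff_lt] at this
    rw [← hj, hc'.le_iff_le]
    omega
  funext i
  induction i using Int.induction_on with
  | zero => exact le_antisymm (key0 hc' h h0 h1') (key0 hc h' h0' h1)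
  | succ i ih => exact le_antisymm (key hc' hc h' i ih.symm).1 (key hc hc' h i ih).1
  | pred i ih => exact le_antisymm (key hc hc' h (-i) ih).2 (key hc' hc h' (-i) ih.symm).2

theorem mem_window {s : ℤ → A} {i : ℤ} {n : ℕ} {b : A} :
    b ∈ window s i n ↔ ∃ j : ℤ, i ≤ j ∧ j < i + n ∧ s j = b := by
  simp only [window, List.mem_ofFn]
  constructor
  · rintro ⟨j, rfl⟩
    exact ⟨i + (j : ℕ), by omega, by omega, rfl⟩
  · rintro ⟨j, h1, h2, rfl⟩
    refine ⟨⟨(j - i).toNat, by omega⟩, ?_⟩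
    congr 1
    simp only
    omega

theorem apply_eq_iff_of_isDecomp {s : ℤ → A} {t : ℤ → φ.ReturnWord a} {c : ℤ → ℤ}
    (h : IsDecomp (fun v : φ.ReturnWord a => v.1) s t c) (n : ℤ) :
    s n = a ↔ ∃ i, c i = n := by
  have key : ∀ i, ∃ u, window s (c i) (u.length + 1) = a :: u ∧ a ∉ u ∧
      c (i + 1) = c i + (u.length + 1 : ℕ) := by
    intro i
    obtain ⟨u, hu, hau⟩ := (t i).exists_eq
    obtain ⟨h1, h2⟩ := h i
    dsimp only at h1 h2
    rw [hu] at h1 h2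
    exact ⟨u, h2, hau, h1⟩
  constructor
  · intro hn
    obtain ⟨i, h1, h2⟩ := h.exists_index (fun v => v.ne_nil) n
    obtain ⟨u, hw, hau, hc⟩ := key i
    refine ⟨i, ?_⟩
    by_contra hne
    rw [window_succ, List.cons.injEq] at hw
    exact hau (hw.2 ▸ mem_window.mpr ⟨n, by omega, by push_cast at hc; omega, hn⟩)
  · rintro ⟨i, rfl⟩
    obtain ⟨u, hw, -⟩ := key i
    rw [window_succ, List.cons.injEq] at hw
    exact hw.1

/-- Bounded gaps make the occurrences of `a` in `s` unbounded in both directions, and the words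
between consecutive ones are return words. In any decomposition the cuts are exactly these
occurrences, which gives uniqueness. -/
theorem IsPrimitive.concatMap_isRecognisable [Fintype A] (hφ : φ.IsPrimitive)
    (h : φ.IsFixedLetter a k) : (concatMap h).IsRecognisable := by
  intro s
  obtain ⟨L, hL⟩ := hφ.exists_gap a
  have hocc : ∀ n : ℤ, ∃ m, n ≤ m ∧ m < n + (L + 1 : ℕ) ∧ s.1 m = a := by
    intro n
    have h1 := hL _ (s.admitted n (L + 1))
    rw [length_window] at h1
    by_contra hno
    exact absurd (h1 fun hm => hno (mem_window.mp hm)) (by omega)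
  obtain ⟨c, hc, hcs, hc0, hc1⟩ := exists_strictMono_range_eq (Q := fun n => s.1 n = a)
    (fun n => let ⟨m, h1, _, h3⟩ := hocc (n + 1); ⟨m, by omega, h3⟩)
    (fun n => let ⟨m, _, h2, h3⟩ := hocc (n - (L + 1 : ℕ)); ⟨m, by omega, h3⟩)
  have hword : ∀ i, ∃ v : φ.ReturnWord a, c (i + 1) = c i + (v.1.length : ℤ) ∧
      window s.1 (c i) v.1.length = v.1 := by
    intro i
    obtain ⟨l, hl⟩ : ∃ l : ℕ, c (i + 1) = c i + (l + 1 : ℕ) :=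
      ⟨(c (i + 1) - c i - 1).toNat, by have := hc (show i < i + 1 by omega); omega⟩
    have e : window s.1 (c i) (l + 1) = a :: window s.1 (c i + 1) l := by
      rw [window_succ, (hcs (c i)).mpr ⟨i, rfl⟩]
    refine ⟨⟨window s.1 (c i) (l + 1), ⟨_, e, fun hm => ?_⟩, ?_⟩, by simpa using hl, by simp⟩
    · obtain ⟨j, h1, h2, h3⟩ := mem_window.mp hm
      obtain ⟨m, rfl⟩ := (hcs j).mp h3
      have a1 := hc.lt_iff_lt.mp (show c i < c m by omega)
      have a2 := hc.lt_iff_lt.mp (show c m < c (i + 1) by push_cast at hl; omega)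
      omega
    · have := s.admitted (c i) (l + 1 + 1)
      rwa [window_succ' _ _ (l + 1), ← hl, (hcs _).mpr ⟨i + 1, rfl⟩] at this
  choose t ht using hword
  have hdec : IsDecomp (fun v : φ.ReturnWord a => v.1) s.1 t c := ht
  have htX : ∀ (i : ℤ) (n : ℕ), (φ.preLeftProperisation a k h).Admitted (window t i n) := by
    intro i n
    have h1 := hdec.window_eq i n
    -- One more letter is read: it is the `a` at the next cut, needed to recover the return words.
    have h2 := s.admitted (c i) (((window t i n).flatMap fun v => v.1).length + 1)
    rw [window_succ', h1, ← hdec.cut_add, (hcs _).mpr ⟨_, rfl⟩] at h2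
    obtain ⟨N, hN⟩ := hφ.exists_infix_iter_returnWord h h2
    exact Or.inr ⟨t 0, N, hN N le_rfl _⟩
  refine ⟨(⟨t, htX⟩, c), ⟨hdec, hc0, hc1⟩, ?_⟩
  rintro ⟨t', c'⟩ ⟨hdec', hc0', hc1'⟩
  have hdec'' : IsDecomp (fun v : φ.ReturnWord a => v.1) s.1 t'.1 c' := hdec'
  have hc' := hdec''.strictMono fun v => v.ne_nil
  obtain rfl : c' = c := eq_of_strictMono_of_range_eq hc' hc
    (fun i => (apply_eq_iff_of_isDecomp hdec _).mp
      ((apply_eq_iff_of_isDecomp hdec'' _).mpr ⟨i, rfl⟩))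
    (fun i => (apply_eq_iff_of_isDecomp hdec'' _).mp
      ((apply_eq_iff_of_isDecomp hdec _).mpr ⟨i, rfl⟩)) hc0' hc1' hc0 hc1
  refine Prod.ext (Subtype.ext (funext fun i => Subtype.ext ?_)) rfl
  obtain ⟨a1, a2⟩ := hdec i
  obtain ⟨b1, b2⟩ := hdec'' i
  dsimp only at a1 a2 b1 b2 ⊢
  have e : (t'.1 i).1.length = (t i).1.length := by omega
  rw [← a2, ← b2, e]

theorem IsPrimitive.selfMap_coinvTransfer_bijective [Fintype A] (hφ : φ.IsPrimitive)
    (h : φ.IsFixedLetter a k) (hrec : φ.IsRecognisable) :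
    Function.Bijective (φ.preLeftProperisation a k h).selfMap.tower.coinvTransfer := by
  have := hφ.finite_returnWord a
  have hc := (hφ.concatMap_isRecognisable h).coinvTransfer_bijective
  have hk := hrec.coinvTransfer_powMap_bijective k
  have e : (φ.preLeftProperisation a k h).selfMap.tower.coinvTransfer
        ∘ (concatMap h).tower.coinvTransfer
      = (concatMap h).tower.coinvTransfer ∘ (φ.powMap k).tower.coinvTransfer := by
    funext x
    simp only [Function.comp_apply, ← WordMap.comp_coinvTransfer, concatMap_comp_selfMap]
  have hb := hc.comp hk
  rw [← e] at hb
  exact (Function.Bijective.of_comp_iff _ hc).mp hb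

theorem length_iter_ge (φ : Substitution A) (n : ℕ) (w : List A) :
    w.length ≤ (φ.iter n w).length := by
  rw [iter_eq_flatMap]
  exact IsDecomp.length_flatMap_ge (φ.powMap n).ne_nil w

/-- Under a left proper power every letter becomes a common letter followed by at least one more, so
each application lengthens all words. -/
theorem IsPreLeftProper.exists_length_ge {φ : Substitution A} (hφ : φ.IsPreLeftProper) (m : ℕ) :
    ∃ n₀, ∀ n, n₀ ≤ n → ∀ c, m ≤ (φ.iter n [c]).length := by
  obtain ⟨i, -, b, hb⟩ := hφ
  have key : ∀ m c, m ≤ (φ.iter (m * i) [c]).length := by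
    intro m
    induction m with
    | zero => simp
    | succ m ih =>
      intro c
      obtain ⟨w, hw, e⟩ := hb c
      have e' : φ.iter i [c] = b :: w := e
      have := φ.length_iter_ge (m * i) w
      have hw' := List.length_pos_iff.mpr hw
      rw [add_mul, one_mul, iter_add, e', ← List.singleton_append, iter_append,
        List.length_append]
      have := ih b
      omega
  refine ⟨m * i, fun n hn c => ?_⟩
  obtain ⟨l, rfl⟩ := Nat.exists_eq_add_of_le' hn
  rw [iter_add]
  exact (key m c).trans (φ.length_iter_ge l _)

/-- Every return word occurs in the subshift of the pre-left properisation. -/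
theorem IsPrimitive.exists_apply_zero_eq [Fintype A] (hφ : φ.IsPrimitive)
    (h : φ.IsFixedLetter a k) (v : φ.ReturnWord a) :
    ∃ t : (φ.preLeftProperisation a k h).Subshift, t.1 0 = v := by
  have := hφ.finite_returnWord a
  have : Nonempty (φ.ReturnWord a) := ⟨v⟩
  have hpl := hφ.isPreLeftProper h
  have hv : φ.Admitted (φ.concat a [v] ++ [a]) := by
    rw [concat_cons, concat_nil, List.append_nil]
    exact v.2.2
  obtain ⟨N₀, hN⟩ := hφ.exists_infix_iter_returnWord h hv
  refine Subshift.exists_apply_zero_eq v fun N => ?_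
  obtain ⟨n₀, hn⟩ := hpl.exists_length_ge N
  -- Three letters suffice: an image of the middle one contains `v`, and the images of its
  -- neighbours supply arbitrarily long margins.
  obtain ⟨n₁, hn₁⟩ := hpl.exists_length_ge 3
  have h3 := hn₁ n₁ le_rfl v
  obtain ⟨x, y, z, w, hw⟩ : ∃ x y z w,
      (φ.preLeftProperisation a k h).iter n₁ [v] = x :: y :: z :: w := by
    match e : (φ.preLeftProperisation a k h).iter n₁ [v] with
    | [] => simp [e] at h3
    | [_] => simp [e] at h3
    | [_, _] => simp [e] at h3
    | x :: y :: z :: w => exact ⟨x, y, z, w, rfl⟩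
  set ψ := φ.preLeftProperisation a k h
  let M := N₀ + n₀
  obtain ⟨p, q, hpq⟩ := hN M (by omega) y
  have hx := hn M (by omega) x
  have hz := hn M (by omega) z
  have e : ψ.iter (M + n₁) [v]
      = (ψ.iter M [x] ++ p) ++ v :: (q ++ (ψ.iter M [z] ++ ψ.iter M w)) := by
    rw [iter_add, hw, show x :: y :: z :: w = [x] ++ ([y] ++ ([z] ++ w)) from rfl, iter_append,
      iter_append, iter_append, ← hpq]
    simp
  refine ⟨ψ.iter M [x] ++ p, q ++ (ψ.iter M [z] ++ ψ.iter M w), ?_, ?_,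
    Or.inr ⟨v, M + n₁, [], [], by rw [e]; simp⟩⟩ <;>
    simp only [List.length_append] <;> omega

end ReturnWord

end Substitution

namespace Substitution

variable {B : Type u} {θ : Substitution B}

/-! ### Coinvariants as a direct limit -/

theorem window_base (θ : Substitution B) (n : ℕ) (t : θ.Subshift) (q : ℕ) :
    window ((θ.powMap n).base t).1 0 (θ.iter n (window t.1 0 q)).length
      = θ.iter n (window t.1 0 q) := by
  have := ((θ.powMap n).isDecomp t).window_eq 0 q
  rw [WordMap.cut_zero] at this
  rw [iter_eq_flatMap]
  exact this

/-- The images of `q` known letters fill at least `q` positions, and the following block starts with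
the common letter `b` whatever it is. Thus one position is gained. -/
theorem eqOn_base_succ {i : ℕ} (hi : (θ.pow i).IsLeftProper) {t t' : θ.Subshift} {q : ℕ}
    (h : ∀ j : ℤ, 0 ≤ j → j < q → t.1 j = t'.1 j) {j : ℤ} (hj : 0 ≤ j) (hjq : j < (q + 1 : ℕ)) :
    ((θ.powMap i).base t).1 j = ((θ.powMap i).base t').1 j := by
  obtain ⟨b, hb⟩ := hi
  have hw : window t.1 0 q = window t'.1 0 q := window_congr fun j h1 h2 => h j h1 (by omega)
  have key : ∀ s : θ.Subshift,
      window ((θ.powMap i).base s).1 0 ((θ.iter i (window s.1 0 q)).length + 1)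
        = θ.iter i (window s.1 0 q) ++ [b] := by
    intro s
    obtain ⟨w, -, hw⟩ := hb (s.1 (0 + q))
    have hw' : θ.iter i [s.1 (0 + q)] = b :: w := hw
    have e := θ.window_base i s (q + 1)
    rw [window_succ', iter_append, hw', ← List.singleton_append, ← List.append_assoc,
      List.length_append, window_add] at e
    have := (List.append_inj e (by simp)).1
    simpa using this
  have e := key t
  rw [hw, ← key t'] at e
  have hl := θ.length_iter_ge i (window t'.1 0 q)
  rw [length_window] at hl
  exact eq_of_window_eq e hj (by push_cast at hjq ⊢; omega)

theorem IsPreLeftProper.exists_eqOn_base (hθ : θ.IsPreLeftProper) (m : ℕ) :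
    ∃ n, ∀ (t t' : θ.Subshift) (j : ℤ), 0 ≤ j → j < m →
      ((θ.powMap n).base t).1 j = ((θ.powMap n).base t').1 j := by
  obtain ⟨i, -, hi⟩ := hθ
  induction m with
  | zero => exact ⟨0, fun t t' j h1 h2 => by push_cast at h2; omega⟩
  | succ m ih =>
    obtain ⟨n, hn⟩ := ih
    refine ⟨i + n, fun t t' j h1 h2 => ?_⟩
    rw [powMap_add, WordMap.comp_base, WordMap.comp_base]
    exact eqOn_base_succ hi (fun j => hn t t' j) h1 h2

/-- Evaluation at the letter in position `0`. -/
def letterFun (θ : Substitution B) : (B → ℤ) →ₗ[ℤ] C(θ.Subshift, ℤ) where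
  toFun g := ⟨fun t => g (t.1 0), ((Subshift.isLocallyConstant_apply θ 0).comp g).continuous⟩
  map_add' _ _ := rfl
  map_smul' _ _ := rfl

theorem letterFun_apply (g : B → ℤ) (t : θ.Subshift) : θ.letterFun g t = g (t.1 0) := rfl

theorem birkhoffSum_letterFun (g : B → ℤ) (n : ℕ) (t : θ.Subshift) :
    birkhoffSum (Subshift.shiftMap θ) (θ.letterFun g) n t = ((window t.1 0 n).map g).sum := by
  induction n with
  | zero => simp
  | succ n ih =>
    rw [birkhoffSum_succ, ih, window_succ', letterFun_apply, Subshift.iterate_shiftMap_apply]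
    simp

section Fintype

variable [Fintype B]

theorem sum_map_toFun (θ : Substitution B) (g : B → ℤ) (b : B) :
    ((θ.toFun b).map g).sum = θ.matrix.transpose.mulVecLin g b := by
  classical
  rw [Finset.sum_list_map_count, Matrix.mulVecLin_apply, Matrix.mulVec, dotProduct]
  rw [Finset.sum_subset (Finset.subset_univ _)]
  · refine Finset.sum_congr rfl fun x _ => ?_
    rw [Matrix.transpose_apply, matrix, Matrix.of_apply, nsmul_eq_mul]
  · intro x _ hx
    rw [List.count_eq_zero_of_not_mem (by simpa using hx), zero_smul]

theorem transfer_letterFun (θ : Substitution B) (g : B → ℤ) :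
    θ.selfMap.tower.transfer (θ.letterFun g)
      = θ.letterFun (θ.matrix.transpose.mulVecLin g) := by
  ext t
  have h := (θ.selfMap.isDecomp t 0).2
  rw [WordMap.cut_zero] at h
  rw [TowerMap.transfer_apply, birkhoffSum_letterFun, letterFun_apply, ← sum_map_toFun,
    WordMap.tower_base, WordMap.tower_height, h]
  rfl

theorem transfer_powMap_letterFun (θ : Substitution B) (n : ℕ) (g : B → ℤ) :
    (θ.powMap n).tower.transfer (θ.letterFun g)
      = θ.letterFun ((θ.matrix.transpose.mulVecLin ^ n) g) := by
  induction n with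
  | zero => exact transfer_powMap_zero θ _
  | succ n ih =>
    rw [powMap_add, powMap_one, WordMap.comp_transfer, ih, transfer_letterFun, pow_succ',
      Module.End.mul_apply]

/-- Up to coboundaries, a continuous function depends on non-negative coordinates only. -/
theorem exists_forward_window (F : C(θ.Subshift, ℤ)) :
    ∃ (F' : C(θ.Subshift, ℤ)) (N : ℕ),
      (Submodule.Quotient.mk F' : Coinvariants (Subshift.shiftMap θ)) = Submodule.Quotient.mk F ∧
      ∀ s t : θ.Subshift, (∀ i : ℤ, 0 ≤ i → i < N → s.1 i = t.1 i) → F' s = F' t := by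
  have key : ∀ N : ℕ, ∃ F' : C(θ.Subshift, ℤ),
      (Submodule.Quotient.mk F' : Coinvariants (Subshift.shiftMap θ)) = Submodule.Quotient.mk F ∧
      ∀ s, F' s = F ((Subshift.shiftMap θ)^[N] s) := by
    intro N
    induction N with
    | zero => exact ⟨F, rfl, fun _ => rfl⟩
    | succ N ih =>
      obtain ⟨F', h1, h2⟩ := ih
      refine ⟨F'.comp (Subshift.shiftMap θ), ?_, fun s => h2 _⟩
      rw [← h1]
      -- Composing with the shift changes a function by a coboundary.
      exact ((Submodule.Quotient.eq (LinearMap.range (dynCoboundary (Subshift.shiftMap θ)))).mpr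
        ⟨F', rfl⟩).symm
  obtain ⟨N, hN⟩ := Subshift.exists_window F
  obtain ⟨F', h1, h2⟩ := key N
  refine ⟨F', N + N, h1, fun s t hst => ?_⟩
  rw [h2, h2]
  refine hN _ _ fun i hi1 hi2 => ?_
  rw [Subshift.iterate_shiftMap_apply, Subshift.iterate_shiftMap_apply]
  exact hst _ (by omega) (by push_cast; omega)

/-- Summing over the block of `t 0` a function of `N` forward letters reads only that block and
fewer than `N` letters beyond it if `N > 0`. For large `n` the latter are the same for all
sequences, so the sum depends on `t 0` alone. -/
theorem IsPreLeftProper.exists_transfer_eq (hθ : θ.IsPreLeftProper)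
    (hocc : ∀ b, ∃ t : θ.Subshift, t.1 0 = b) (F : C(θ.Subshift, ℤ)) :
    ∃ (n : ℕ) (g : B → ℤ), (θ.powMap n).tower.coinvTransfer (Submodule.Quotient.mk F)
      = Submodule.Quotient.mk (θ.letterFun g) := by
  obtain ⟨F', N, hF', hN⟩ := exists_forward_window F
  obtain ⟨n, hn⟩ := hθ.exists_eqOn_base N
  choose r hr using hocc
  -- The value at `b` is read off at a chosen point of the subshift with `b` at position `0`.
  refine ⟨n, fun b => (θ.powMap n).tower.transfer F' (r b), ?_⟩
  rw [← hF', TowerMap.coinvTransfer_mk]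
  congr 1
  ext t
  rw [letterFun_apply]
  set t' := r (t.1 0)
  have ht : t'.1 0 = t.1 0 := hr _
  rw [TowerMap.transfer_apply, TowerMap.transfer_apply, WordMap.tower_height,
    WordMap.tower_height, ht, WordMap.tower_base, WordMap.tower_base]
  set l := ((θ.powMap n).toFun (t.1 0)).length with hl
  have hshift : ∀ (s : θ.Subshift) (i : ℤ), s.1 0 = t.1 0 →
      ((θ.powMap n).base s).1 (i + l)
        = ((θ.powMap n).base (Subshift.shiftMap θ s)).1 i := by
    intro s i hs
    rw [← WordMap.base_shift, Subshift.iterate_shiftMap_apply, hs]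
  have hword : ∀ s : θ.Subshift, s.1 0 = t.1 0 →
      window ((θ.powMap n).base s).1 0 l = (θ.powMap n).toFun (t.1 0) := by
    intro s hs
    have := ((θ.powMap n).isDecomp s 0).2
    rwa [WordMap.cut_zero, hs] at this
  have hagree : ∀ i : ℤ, 0 ≤ i → i < l + N →
      ((θ.powMap n).base t).1 i = ((θ.powMap n).base t').1 i := by
    intro i h1 h2
    rcases lt_or_ge i l with h | h
    · exact eq_of_window_eq ((hword t rfl).trans (hword t' ht).symm) h1 (by omega)
    · have e := hn (Subshift.shiftMap θ t) (Subshift.shiftMap θ t') (i - l) (by omega) (by omega)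
      rwa [← hshift t _ rfl, ← hshift t' _ ht, sub_add_cancel] at e
  refine Finset.sum_congr rfl fun j hj => hN _ _ fun i h1 h2 => ?_
  have hj' := Finset.mem_range.mp hj
  rw [Subshift.iterate_shiftMap_apply, Subshift.iterate_shiftMap_apply]
  exact hagree _ (by omega) (by omega)

/-- If the letter function is `h - h ∘ σ`, then `h` depends on forward letters only, so it is
constant on the image of a high power. The transfer of the coboundary by that power vanishes, and as
every letter occurs, so does the vector. -/
theorem IsPreLeftProper.exists_pow_eq_zero (hθ : θ.IsPreLeftProper)
    (hocc : ∀ b, ∃ t : θ.Subshift, t.1 0 = b) {g : B → ℤ}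
    (hg : θ.letterFun g ∈ LinearMap.range (dynCoboundary (Subshift.shiftMap θ))) :
    ∃ n, (θ.matrix.transpose.mulVecLin ^ n) g = 0 := by
  obtain ⟨h, hh⟩ := hg
  obtain ⟨N, hN⟩ := Subshift.exists_window h
  -- Telescoping over `N` steps writes `h s` as `h (σ^N s)` plus a sum over the first `N` letters,
  -- which removes the negative coordinates.
  have hfw : ∀ s t : θ.Subshift, (∀ i : ℤ, 0 ≤ i → i < (N + N : ℕ) → s.1 i = t.1 i) →
      h s = h t := by
    intro s t hst
    have e1 : h ((Subshift.shiftMap θ)^[N] s) = h ((Subshift.shiftMap θ)^[N] t) := by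
      refine hN _ _ fun i hi1 hi2 => ?_
      rw [Subshift.iterate_shiftMap_apply, Subshift.iterate_shiftMap_apply]
      exact hst _ (by omega) (by push_cast; omega)
    have e2 : window s.1 0 N = window t.1 0 N :=
      window_congr fun j h1 h2 => hst j h1 (by push_cast; omega)
    have a1 := TowerMap.birkhoffSum_dynCoboundary (T := Subshift.shiftMap θ) h N s
    have a2 := TowerMap.birkhoffSum_dynCoboundary (T := Subshift.shiftMap θ) h N t
    rw [hh, birkhoffSum_letterFun] at a1 a2
    rw [e2] at a1
    linarith
  obtain ⟨n, hn⟩ := hθ.exists_eqOn_base (N + N)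
  refine ⟨n, funext fun b => ?_⟩
  obtain ⟨t, rfl⟩ := hocc b
  have e := DFunLike.congr_fun (transfer_powMap_letterFun θ n g) t
  rw [← hh, TowerMap.transfer_dynCoboundary, letterFun_apply] at e
  rw [← e]
  exact sub_eq_zero.mpr (hfw _ _ fun i h1 h2 => hn _ _ i h1 h2)

/-- The coinvariants of a pre-left proper substitution whose transfer is invertible. -/
theorem IsPreLeftProper.nonempty_coinvariants_equiv (hθ : θ.IsPreLeftProper)
    (hocc : ∀ b, ∃ t : θ.Subshift, t.1 0 = b)
    (hbij : Function.Bijective θ.selfMap.tower.coinvTransfer) :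
    Nonempty (Coinvariants (Subshift.shiftMap θ) ≃+ θ.TransposeLimit) := by
  let M : (B → ℤ) →ₗ[ℤ] (B → ℤ) := θ.matrix.transpose.mulVecLin
  let p : Coinvariants (Subshift.shiftMap θ) ≃ₗ[ℤ] Coinvariants (Subshift.shiftMap θ) :=
    LinearEquiv.ofBijective _ hbij
  let q : Module.End ℤ (Coinvariants (Subshift.shiftMap θ)) := p.symm.toLinearMap
  let E : (B → ℤ) →ₗ[ℤ] Coinvariants (Subshift.shiftMap θ) :=
    (Submodule.mkQ _).comp θ.letterFun
  have hp : ∀ n x, (θ.powMap n).tower.coinvTransfer x = p^[n] x :=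
    fun n x => θ.coinvTransfer_powMap n x
  have hq : ∀ n x, (q ^ n) x = p.symm^[n] x := fun n x => Module.End.pow_apply q n x
  have hqp : ∀ n x, (q ^ n) (p^[n] x) = x := fun n x => by
    rw [hq]
    exact Function.LeftInverse.iterate p.symm_apply_apply n x
  have hpq : ∀ n x, p^[n] ((q ^ n) x) = x := fun n x => by
    rw [hq]
    exact Function.LeftInverse.iterate p.apply_symm_apply n x
  have hE : ∀ n g, E ((M ^ n) g) = p^[n] (E g) := fun n g => by
    rw [← hp]
    exact congrArg Submodule.Quotient.mk (θ.transfer_powMap_letterFun n g).symm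
  have hcompat : ∀ i j (hij : i ≤ j) (g : B → ℤ),
      ((q ^ j).comp E) ((M ^ (j - i)) g) = ((q ^ i).comp E) g := by
    intro i j hij g
    obtain ⟨d, rfl⟩ := Nat.exists_eq_add_of_le hij
    rw [LinearMap.comp_apply, Nat.add_sub_cancel_left, hE, pow_add, Module.End.mul_apply, hqp]
    rfl
  -- A vector at stage `n` goes to the class of its letter function moved back by `p⁻ⁿ`; this fits
  -- together because `E` intertwines `M` with `p`.
  let Λ : θ.TransposeLimit →ₗ[ℤ] Coinvariants (Subshift.shiftMap θ) :=
    Module.DirectLimit.lift ℤ ℕ _ _ (fun n => (q ^ n).comp E) hcompat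
  have hΛ : ∀ n g, Λ (Module.DirectLimit.of ℤ ℕ (fun _ => B → ℤ)
      (fun i j _ => M ^ (j - i)) n g) = (q ^ n) (E g) := fun n g =>
    Module.DirectLimit.lift_of _ _ _
  have hbijΛ : Function.Bijective Λ := by
    constructor
    · refine (injective_iff_map_eq_zero _).mpr fun z hz => ?_
      obtain ⟨i, g, rfl⟩ := Module.DirectLimit.exists_of z
      rw [hΛ] at hz
      have hEg : E g = 0 := by
        rw [← hpq i (E g), hz, ← hp, map_zero]
      obtain ⟨n, hn⟩ := hθ.exists_pow_eq_zero hocc ((Submodule.Quotient.mk_eq_zero _).mp hEg)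
      rw [← Module.DirectLimit.of_f (hij := Nat.le_add_right i n), Nat.add_sub_cancel_left, hn,
        map_zero]
    · intro x
      obtain ⟨F, rfl⟩ := Submodule.Quotient.mk_surjective _ x
      obtain ⟨n, g, hg⟩ := hθ.exists_transfer_eq hocc F
      refine ⟨Module.DirectLimit.of ℤ ℕ _ _ n g, ?_⟩
      rw [hΛ]
      have : E g = p^[n] (Submodule.Quotient.mk F) := by rw [← hp, hg]; rfl
      rw [this, hqp]
  exact ⟨(LinearEquiv.ofBijective Λ hbijΛ).symm.toAddEquiv⟩

theorem subsingleton_transposeLimit [IsEmpty B] : Subsingleton θ.TransposeLimit := by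
  refine subsingleton_of_forall_eq 0 fun z => ?_
  obtain ⟨i, g, rfl⟩ := Module.DirectLimit.exists_of z
  rw [Subsingleton.elim g 0, map_zero]

end Fintype

theorem subsingleton_coinvariants [IsEmpty B] :
    Subsingleton (Coinvariants (Subshift.shiftMap θ)) := by
  have : IsEmpty θ.Subshift := ⟨fun t => isEmptyElim (t.1 0)⟩
  refine subsingleton_of_forall_eq 0 fun z => ?_
  obtain ⟨F, rfl⟩ := Submodule.Quotient.mk_surjective _ z
  rw [show F = 0 from ContinuousMap.ext fun t => isEmptyElim t]
  rfl

end Substitution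

/-! ### Assembling the three claims -/

theorem mainTheorem2 {A : Type u} [Fintype A] (φ : Substitution A) (hφ : φ.IsPrimitive)
    (a : A) (k : ℕ) (ha : φ.IsFixedLetter a k) :
    ∃ _ : Fintype (φ.ReturnWord a),
      (Nonempty (φ.ReturnWord a) → (φ.preLeftProperisation a k ha).IsPreLeftProper) ∧
      Nonempty (CechCohomology 1 (φ.preLeftProperisation a k ha).TilingSpace ≃+
        CechCohomology 1 φ.TilingSpace) ∧
      (φ.IsRecognisable →
        Nonempty (CechCohomology 1 φ.TilingSpace ≃+
          (φ.preLeftProperisation a k ha).TransposeLimit)) := by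
  have := hφ.finite_returnWord a
  let _ : Fintype (φ.ReturnWord a) := Fintype.ofFinite _
  have e : Coinvariants (Substitution.Subshift.shiftMap φ) ≃ₗ[ℤ]
      Coinvariants (Substitution.Subshift.shiftMap (φ.preLeftProperisation a k ha)) :=
    LinearEquiv.ofBijective _ (hφ.concatMap_isRecognisable ha).coinvTransfer_bijective
  refine ⟨inferInstance, fun _ => hφ.isPreLeftProper ha,
    ⟨((φ.preLeftProperisation a k ha).cechEquivCoinvariants.trans
      (e.symm.trans φ.cechEquivCoinvariants.symm)).toAddEquiv⟩, fun hrec => ?_⟩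
  -- Without return words both groups are trivial, and left properness is not available.
  rcases isEmpty_or_nonempty (φ.ReturnWord a) with hR | hR
  · have := Substitution.subsingleton_transposeLimit (θ := φ.preLeftProperisation a k ha)
    have := Substitution.subsingleton_coinvariants (θ := φ.preLeftProperisation a k ha)
    exact ⟨(φ.cechEquivCoinvariants.trans e).toAddEquiv.trans
      { toFun := fun _ => 0
        invFun := fun _ => 0
        left_inv := fun _ => Subsingleton.elim _ _
        right_inv := fun _ => Subsingleton.elim _ _
        map_add' := fun _ _ => Subsingleton.elim _ _ }⟩
  · obtain ⟨f⟩ := (hφ.isPreLeftProper ha).nonempty_coinvariants_equiv (hφ.exists_apply_zero_eq ha)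
      (hφ.selfMap_coinvTransfer_bijective ha hrec)
    exact ⟨(φ.cechEquivCoinvariants.trans e).toAddEquiv.trans f⟩
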